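/- Let $n,m,d,b$ be positive integers and $f\in\mathbb{R}^d$. Each of $m$ machines $j=1,\dots,m$ observes $X^j=f+\sqrt{m/n}\,Z^j$, where $Z^1,\dots,Z^m$ are independent standard normal vectors in $\mathbb{R}^d$, and sends a transcript $Y^j$ with values in a finite space $\mathcal{Y}^j$, $|\mathcal{Y}^j|\le 2^b$. A test is a map $T:\prod_{j}\mathcal{Y}^j\to\{0,1\}$ applied to $Y=(Y^1,\dots,Y^m)$. In a private coin protocol, conditionally on $X=(X^1,\dots,X^m)$ the transcripts are independent with $Y^j\sim K^j(\cdot\mid X^j)$ for Markov kernels $K^j$. In a public coin protocol there is in addition a random variable $U$, independent of $X$, with values in an arbitrary probability space, and conditionally on $(X,U)$ the transcripts are independent with $Y^j\sim K^j(\cdot\mid X^j,U)$ for Markov kernels $K^j$. Let $\mathcal{T}_{\mathrm{priv}}(b)$ and $\mathcal{T}_{\mathrm{pub}}(b)$ be the classes of all private and of all public coin protocols (test, kernels and, for public coin protocols, law of $U$). Write $\mathbb{P}_f$ for the joint law of all the variables when the signal is $f$, put $H_\rho=\{f\in\mathbb{R}^d:\|f\|_2\ge\rho\}$, and define the testing risk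 $$\mathcal{R}(H_\rho,T)=\mathbb{P}_0\big(T(Y)=1\big)+\sup_{f\in H_\rho}\mathbb{P}_f\big(T(Y)=0\big).$$ Theorem. For each $\alpha\in(0,1)$ there is a constant $c_\alpha>0$, depending only on $\alpha$, such that for all positive integers $n,m,d,b$ and all $\rho$ the following hold. (i) If $\rho^2<c_\alpha\frac{\sqrt d}{n}\Big(\sqrt{\frac{d}{b\wedge d}}\wedge\sqrt m\Big)$, then $\inf_{T\in\mathcal{T}_{\mathrm{pub}}(b)}\mathcal{R}(H_\rho,T)>\alpha$. (ii) If $\rho^2<c_\alpha\frac{\sqrt d}{n}\Big(\frac{d}{b\wedge d}\wedge\sqrt m\Big)$, then $\inf_{T\in\mathcal{T}_{\mathrm{priv}}(b)}\mathcal{R}(H_\rho,T)>\alpha$. -/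

import Mathlib

open MeasureTheory ProbabilityTheory

universe u v

noncomputable section

namespace DistributedTesting

/-- Signals and local observations live in `ℝ^d` with the Euclidean norm. -/
abbrev Vec (d : ℕ) : Type := EuclideanSpace ℝ (Fin d)

/-- The law of one local observation `X^j = f + √(m/n) Z^j`, with `Z^j` standard normal on `ℝ^d`. -/
def localLaw (n m : ℕ) {d : ℕ} (f : Vec d) : Measure (Vec d) :=
  (stdGaussian (Vec d)).map (fun z => f + √((m : ℝ) / (n : ℝ)) • z)

instance (n m : ℕ) {d : ℕ} (f : Vec d) : IsProbabilityMeasure (localLaw n m f) :=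
  Measure.isProbabilityMeasure_map (by fun_prop)

/-- The law `P_f` of the data `X = (X^1, …, X^m)`: the local observations are independent. -/
def dataLaw (n m : ℕ) {d : ℕ} (f : Vec d) : Measure (Fin m → Vec d) :=
  Measure.pi (fun _ => localLaw n m f)

instance (n m : ℕ) {d : ℕ} (f : Vec d) : IsProbabilityMeasure (dataLaw n m f) := by
  unfold dataLaw; infer_instance

/-- The alternative hypothesis `H_ρ = {f ∈ ℝ^d : ‖f‖₂ ≥ ρ}`. -/
def alternative (d : ℕ) (ρ : ℝ) : Set (Vec d) := {f | ρ ≤ ‖f‖}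

/-- The product `a ↦ ⊗_j κ_j(· | a)` of finitely many Markov kernels with a common source. -/
def piKernel {ι A : Type*} [Fintype ι] {B : ι → Type*} [MeasurableSpace A]
    [∀ j, MeasurableSpace (B j)] (κ : ∀ j, Kernel A (B j)) [∀ j, IsMarkovKernel (κ j)] :
    Kernel A (∀ j, B j) where
  toFun a := Measure.pi (fun j => κ j a)
  measurable' := by
    refine Measurable.measure_of_isPiSystem_of_isProbabilityMeasure
      generateFrom_pi.symm isPiSystem_pi ?_
    rintro s ⟨t, ht, rfl⟩
    have ht' : ∀ j, MeasurableSet (t j) := fun j => ht j (Set.mem_univ j)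
    simp only [Measure.pi_pi]
    exact Finset.measurable_fun_prod _ (fun j _ => (κ j).measurable_coe (ht' j))

instance {ι A : Type*} [Fintype ι] {B : ι → Type*} [MeasurableSpace A]
    [∀ j, MeasurableSpace (B j)] (κ : ∀ j, Kernel A (B j)) [∀ j, IsMarkovKernel (κ j)] :
    IsMarkovKernel (piKernel κ) :=
  ⟨fun a => inferInstanceAs (IsProbabilityMeasure (Measure.pi (fun j => κ j a)))⟩

/-- A private coin distributed testing protocol with `m` machines, observations in `ℝ^d` and a
communication budget of `b` bits per machine. -/
structure PrivateCoinProtocol (m d b : ℕ) : Type (v + 1) where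
  /-- the space of transcripts of machine `j`: at most `2^b` elements, every subset measurable -/
  Y : Fin m → Type v
  [finite_Y : ∀ j, Finite (Y j)]
  [measurableSpace_Y : ∀ j, MeasurableSpace (Y j)]
  [discrete_Y : ∀ j, DiscreteMeasurableSpace (Y j)]
  card_Y : ∀ j, Nat.card (Y j) ≤ 2 ^ b
  /-- the conditional law of the transcript `Y^j` given `X^j` -/
  K : ∀ j, Kernel (Vec d) (Y j)
  [markov_K : ∀ j, IsMarkovKernel (K j)]
  /-- the test computed from all the transcripts -/
  T : (∀ j, Y j) → Fin 2

/-- A public coin distributed testing protocol with `m` machines, observations in `ℝ^d` and a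
communication budget of `b` bits per machine. -/
structure PublicCoinProtocol (m d b : ℕ) : Type (max (u + 1) (v + 1)) where
  /-- the space in which the public coin takes its values -/
  U : Type u
  [measurableSpace_U : MeasurableSpace U]
  /-- the law of the public coin -/
  PU : Measure U
  [prob_PU : IsProbabilityMeasure PU]
  /-- the space of transcripts of machine `j`: at most `2^b` elements, every subset measurable -/
  Y : Fin m → Type v
  [finite_Y : ∀ j, Finite (Y j)]
  [measurableSpace_Y : ∀ j, MeasurableSpace (Y j)]
  [discrete_Y : ∀ j, DiscreteMeasurableSpace (Y j)]
  card_Y : ∀ j, Nat.card (Y j) ≤ 2 ^ b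
  /-- the conditional law of the transcript `Y^j` given `(X^j, U)` -/
  K : ∀ j, Kernel (Vec d × U) (Y j)
  [markov_K : ∀ j, IsMarkovKernel (K j)]
  /-- the test computed from all the transcripts -/
  T : (∀ j, Y j) → Fin 2

attribute [instance] PrivateCoinProtocol.finite_Y PrivateCoinProtocol.measurableSpace_Y
  PrivateCoinProtocol.discrete_Y PrivateCoinProtocol.markov_K
  PublicCoinProtocol.measurableSpace_U PublicCoinProtocol.prob_PU PublicCoinProtocol.finite_Y
  PublicCoinProtocol.measurableSpace_Y PublicCoinProtocol.discrete_Y PublicCoinProtocol.markov_K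

namespace PrivateCoinProtocol

variable {m d b : ℕ} (P : PrivateCoinProtocol.{v} m d b)

/-- The conditional law `K = ⊗_j K^j(· | X^j)` of `Y = (Y^1, …, Y^m)` given `X`. -/
def transcriptKernel : Kernel (Fin m → Vec d) (∀ j, P.Y j) :=
  piKernel (fun j => (P.K j).comap (fun x : Fin m → Vec d => x j) (measurable_pi_apply j))

instance : IsMarkovKernel P.transcriptKernel := by
  unfold transcriptKernel; infer_instance

/-- The joint law of `(X, Y)` when the signal is `f`. -/
def jointLaw (n : ℕ) (f : Vec d) : Measure ((Fin m → Vec d) × (∀ j, P.Y j)) :=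
  (dataLaw n m f) ⊗ₘ P.transcriptKernel

instance (n : ℕ) (f : Vec d) : IsProbabilityMeasure (P.jointLaw n f) := by
  unfold jointLaw; infer_instance

/-- The testing risk: `P_0(T(Y) = 1) + sup_{f ∈ H_ρ} P_f(T(Y) = 0)`. -/
def risk (n : ℕ) (ρ : ℝ) : ENNReal :=
  P.jointLaw n 0 {ω | P.T ω.2 = 1} + ⨆ f ∈ alternative d ρ, P.jointLaw n f {ω | P.T ω.2 = 0}

end PrivateCoinProtocol

namespace PublicCoinProtocol

variable {m d b : ℕ} (P : PublicCoinProtocol.{u, v} m d b)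

/-- The conditional law `K = ⊗_j K^j(· | X^j, U)` of `Y = (Y^1, …, Y^m)` given `(X, U)`. -/
def transcriptKernel : Kernel ((Fin m → Vec d) × P.U) (∀ j, P.Y j) :=
  piKernel (fun j => (P.K j).comap (fun p : (Fin m → Vec d) × P.U => (p.1 j, p.2))
    (by fun_prop))

instance : IsMarkovKernel P.transcriptKernel := by
  unfold transcriptKernel; infer_instance

/-- The joint law of `((X, U), Y)` when the signal is `f`; the coin `U` is independent of `X`. -/
def jointLaw (n : ℕ) (f : Vec d) : Measure (((Fin m → Vec d) × P.U) × (∀ j, P.Y j)) :=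
  ((dataLaw n m f).prod P.PU) ⊗ₘ P.transcriptKernel

instance (n : ℕ) (f : Vec d) : IsProbabilityMeasure (P.jointLaw n f) := by
  unfold jointLaw; infer_instance

/-- The testing risk: `P_0(T(Y) = 1) + sup_{f ∈ H_ρ} P_f(T(Y) = 0)`. -/
def risk (n : ℕ) (ρ : ℝ) : ENNReal :=
  P.jointLaw n 0 {ω | P.T ω.2 = 1} + ⨆ f ∈ alternative d ρ, P.jointLaw n f {ω | P.T ω.2 = 0}

end PublicCoinProtocol

end DistributedTesting

end

/-!
The proof is a chi-square (Le Cam) lower bound for a prior made of random signs along an orthonormal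
family, together with an order-preserving comparison of kernels that separates the part of the
information on which the communication constraint acts.

After dividing by the noise level `σ = √(m/n)`, machine `j` observes `N(t, I)` and applies a
randomized quantizer `w_y(z)`. Write `p_y` and `μ_y` for the probability of the symbol `y` and the
conditional mean of the observation given `y`, both under `t = 0`. The second moment of the
likelihood ratio of the transcripts, under a prior on `t`, is the average of `∏_j G_j(s, t)` over
two independent draws `s`, `t` from the prior, where `G_j = ∑_y P_s(y) P_t(y) / p_y` is
`Quantizer.chiKernel`.

Write the likelihood ratio as `L_t = 1 + ⟪t, ·⟫ + Q_t`. The inequality `(a + b)² ≤ 2 a² + 2 b²` and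
the contraction of the `L²` norm under conditioning give, in the order of positive semidefinite
kernels, `G_j ≤ 1 + 2 ⟪s, F_j t⟫ + 2 (exp ⟪s, t⟫ - 1 - ⟪s, t⟫)` with `F_j = ∑_y p_y μ_y ⊗ μ_y`
(`Quantizer.sum_sum_mul_chiKernel_le`). The right side is at most
`exp (2 ⟪s, F_j t⟫) (1 + 2 (exp ⟪s, t⟫ - 1 - ⟪s, t⟫))` in the same order, because power series with
nonnegative coefficients preserve positive semidefiniteness. By the Schur product theorem these
bounds can be multiplied over the machines, and only then is the pointwise bound
`1 + 2 (exp x - 1 - x) ≤ exp (2 x²)` applied (`sum_sum_prod_chiKernel_le`). A pointwise bound for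
`G_j` itself is not available, and it would lose the cancellation in the first order term.

What remains are exponential moments of Rademacher sums. With `t = a ∑_i ε_i e_i`, the exponents
`⟪s, F t⟫`, `F = ∑_j F_j`, and `m ⟪s, t⟫²` have exponential moments close to one as soon as
`a⁴ ∑ ⟪e_i, F e_i'⟫²` and `a⁴ m k` are small, `k` being the number of vectors
(`expect_expect_prod_chiKernel_le`).

The constraint enters through the trace of `F_j`, which is at most `d`, and at most `2 log |Y|`
because a symbol of probability `p` has `‖μ_y‖² ≤ 2 log (1 / p)` (`totalEnergy_le`). For a public
coin the prior uses the coordinate axes, and `F² ≤ m F` bounds the Frobenius norm. For private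
coins the prior may depend on the kernels, and it uses the eigenvectors of `F` with the smaller half
of the eigenvalues, each at most twice the average; this is the whole difference between the two
rates.
-/

noncomputable section

namespace DistributedTesting

/-! ### The Cameron–Martin formula for the standard Gaussian measure -/

theorem lintegral_pi_prod {ι : Type*} [Fintype ι] {A : ι → Type*} [∀ i, MeasurableSpace (A i)]
    (μ : ∀ i, Measure (A i)) [∀ i, IsProbabilityMeasure (μ i)] {f : ∀ i, A i → ENNReal}
    (hf : ∀ i, Measurable (f i)) :
    ∫⁻ x, ∏ i, f i (x i) ∂Measure.pi μ = ∏ i, ∫⁻ x, f i x ∂μ i := by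
  have h := lintegral_prod_eq_prod_lintegral_of_indepFun (μ := Measure.pi μ) Finset.univ
    (fun i (x : ∀ i, A i) => f i (x i)) (iIndepFun_pi (fun i => (hf i).aemeasurable))
    (fun i => (hf i).comp (measurable_pi_apply i))
  rw [h]
  refine Finset.prod_congr rfl fun i _ => ?_
  exact (measurePreserving_eval μ i).lintegral_comp (hf i)

theorem gaussianReal_one_eq_withDensity (t : ℝ) :
    gaussianReal t 1 = (gaussianReal 0 1).withDensity
      (fun x => ENNReal.ofReal (Real.exp (t * x - t ^ 2 / 2))) := by
  rw [gaussianReal_of_var_ne_zero _ one_ne_zero, gaussianReal_of_var_ne_zero _ one_ne_zero,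
    ← withDensity_mul _ (measurable_gaussianPDF _ _) (by fun_prop)]
  congr 1
  ext x
  simp only [gaussianPDF, Pi.mul_apply]
  rw [← ENNReal.ofReal_mul (gaussianPDFReal_nonneg _ _ _)]
  simp only [gaussianPDFReal, mul_assoc, ← Real.exp_add]
  congr 4
  simp
  ring

/-- The likelihood ratio of the Gaussian measure with mean `t` to the centred one. -/
def lik {d : ℕ} (t z : Vec d) : ℝ := Real.exp (inner ℝ t z - ‖t‖ ^ 2 / 2)

variable {d : ℕ}

@[fun_prop]
theorem continuous_lik (t : Vec d) : Continuous (lik t) := by unfold lik; fun_prop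

theorem lik_pos (t z : Vec d) : 0 < lik t z := Real.exp_pos _

@[simp] theorem lik_zero (z : Vec d) : lik 0 z = 1 := by simp [lik]

theorem lik_mul_lik (s t z : Vec d) :
    lik s z * lik t z = Real.exp (inner ℝ s t) * lik (s + t) z := by
  simp only [lik, ← Real.exp_add, inner_add_left, norm_add_sq_real]
  ring_nf

/-- The Cameron–Martin formula. -/
theorem stdGaussian_map_const_add (t : Vec d) :
    (stdGaussian (Vec d)).map (fun z => t + z) =
      (stdGaussian (Vec d)).withDensity (fun z => ENNReal.ofReal (lik t z)) := by
  have hpi : (Measure.pi fun _ : Fin d => gaussianReal 0 1).map (fun x i => t i + x i) =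
      (Measure.pi fun _ : Fin d => gaussianReal 0 1).withDensity
        (fun x => ∏ i, ENNReal.ofReal (Real.exp (t i * x i - t i ^ 2 / 2))) := by
    rw [Measure.pi_map_pi (f := fun i (x : ℝ) => t i + x) (fun i => by fun_prop)]
    simp only [gaussianReal_map_const_add, zero_add]
    refine Measure.pi_eq fun s hs => ?_
    rw [withDensity_apply _ (MeasurableSet.univ_pi hs),
      ← lintegral_indicator (MeasurableSet.univ_pi hs)]
    have : ∀ x : Fin d → ℝ, (Set.univ.pi s).indicator
        (fun x => ∏ i, ENNReal.ofReal (Real.exp (t i * x i - t i ^ 2 / 2))) x =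
        ∏ i, (s i).indicator (fun x => ENNReal.ofReal (Real.exp (t i * x - t i ^ 2 / 2))) (x i) := by
      intro x
      by_cases hx : x ∈ Set.univ.pi s
      · rw [Set.indicator_of_mem hx]
        refine Finset.prod_congr rfl fun i _ => ?_
        rw [Set.indicator_of_mem (hx i (Set.mem_univ i))]
      · rw [Set.indicator_of_notMem hx]
        simp only [Set.mem_univ_pi, not_forall] at hx
        obtain ⟨i, hi⟩ := hx
        exact (Finset.prod_eq_zero (Finset.mem_univ i) (Set.indicator_of_notMem hi _)).symm
    simp only [this]
    rw [lintegral_pi_prod _ (fun i => Measurable.indicator (by fun_prop) (hs i))]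
    refine Finset.prod_congr rfl fun i _ => ?_
    rw [lintegral_indicator (hs i), gaussianReal_one_eq_withDensity (t i),
      withDensity_apply _ (hs i)]
  rw [← map_pi_eq_stdGaussian, Measure.map_map (by fun_prop) (by fun_prop)]
  have h1 : (fun z : Vec d => t + z) ∘ WithLp.toLp 2 =
      WithLp.toLp 2 ∘ fun (x : Fin d → ℝ) i => t i + x i := by
    ext x i; simp
  rw [h1, ← Measure.map_map (by fun_prop) (by fun_prop), hpi]
  ext s hs
  rw [Measure.map_apply (by fun_prop) hs, withDensity_apply _ hs,
    withDensity_apply _ (by measurability), setLIntegral_map hs (by fun_prop) (by fun_prop)]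
  refine lintegral_congr fun x => ?_
  rw [← ENNReal.ofReal_prod_of_nonneg (fun i _ => (Real.exp_pos _).le), ← Real.exp_sum]
  simp only [lik, EuclideanSpace.real_norm_sq_eq, PiLp.inner_apply, Finset.sum_sub_distrib,
    Finset.sum_div]
  simp [mul_comm]

theorem integral_comp_const_add_stdGaussian (t : Vec d) {g : Vec d → ℝ}
    (hg : Measurable g) :
    ∫ z, g (t + z) ∂stdGaussian (Vec d) = ∫ z, g z * lik t z ∂stdGaussian (Vec d) := by
  rw [← integral_map (φ := fun z => t + z) (f := g) (by fun_prop) hg.aestronglyMeasurable,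
    stdGaussian_map_const_add, integral_withDensity_eq_integral_toReal_smul (by fun_prop)
      (by simp)]
  refine integral_congr_ae (.of_forall fun z => ?_)
  simp [ENNReal.toReal_ofReal (lik_pos t z).le, mul_comm]

theorem integral_lik (t : Vec d) : ∫ z, lik t z ∂stdGaussian (Vec d) = 1 := by
  simpa using (integral_comp_const_add_stdGaussian t (g := fun _ => 1) (by fun_prop)).symm

theorem integrable_lik (t : Vec d) : Integrable (lik t) (stdGaussian (Vec d)) :=
  .of_integral_ne_zero (by rw [integral_lik]; exact one_ne_zero)

theorem memLp_lik (t : Vec d) : MemLp (lik t) 2 (stdGaussian (Vec d)) := by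
  rw [memLp_two_iff_integrable_sq (by fun_prop)]
  have : (fun z => lik t z ^ 2) = fun z => Real.exp (inner ℝ t t) * lik (t + t) z := by
    ext z; rw [sq, lik_mul_lik]
  rw [this]
  exact (integrable_lik _).const_mul _

theorem memLp_inner (t : Vec d) : MemLp (fun z => inner ℝ t z) 2 (stdGaussian (Vec d)) := by
  simpa using IsGaussian.memLp_dual (stdGaussian (Vec d)) (innerSL ℝ t) 2 (by simp)

theorem integral_inner_stdGaussian (t : Vec d) : ∫ z, inner ℝ t z ∂stdGaussian (Vec d) = 0 := by
  simpa using integral_strongDual_stdGaussian (innerSL ℝ t)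

theorem integral_lik_mul_lik (s t : Vec d) :
    ∫ z, lik s z * lik t z ∂stdGaussian (Vec d) = Real.exp (inner ℝ s t) := by
  simp_rw [lik_mul_lik]
  rw [integral_const_mul, integral_lik, mul_one]

theorem integral_inner_mul_lik (s t : Vec d) :
    ∫ z, inner ℝ s z * lik t z ∂stdGaussian (Vec d) = inner ℝ s t := by
  rw [← integral_comp_const_add_stdGaussian t (by fun_prop)]
  simp_rw [inner_add_right]
  rw [integral_add (integrable_const _) ((memLp_inner s).integrable (by norm_num)),
    integral_inner_stdGaussian]
  simp

theorem integral_inner_mul_inner (s t : Vec d) :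
    ∫ z, inner ℝ s z * inner ℝ t z ∂stdGaussian (Vec d) = inner ℝ s t := by
  have h := covarianceBilin_apply (μ := stdGaussian (Vec d)) (x := s) (y := t)
    IsGaussian.memLp_two_id
  rw [covarianceBilin_stdGaussian] at h
  simp only [id_eq, integral_id_stdGaussian, sub_zero] at h
  exact h.symm.trans (innerSL_apply_apply ℝ s t)

/-! ### Randomized quantizers of a Gaussian observation -/

/-- A randomized quantizer: `w y z` is the probability of emitting the symbol `y` when the
observation is `z`. -/
structure Quantizer (d : ℕ) (Y : Type*) [Fintype Y] where
  /-- the probability of emitting `y` given the observation `z` -/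
  w : Y → Vec d → ℝ
  measurable_w : ∀ y, Measurable (w y)
  nonneg : ∀ y z, 0 ≤ w y z
  sum_eq_one : ∀ z, ∑ y, w y z = 1

namespace Quantizer

variable {d : ℕ} {Y : Type*} [Fintype Y] (q : Quantizer d Y)

/-- The probability of the symbol `y` when the observation is `N(0, I)`. -/
def prob (y : Y) : ℝ := ∫ z, q.w y z ∂stdGaussian (Vec d)

/-- The probability of the symbol `y` when the observation is `N(t, I)`, written as an integral
against the likelihood ratio. -/
def probAt (t : Vec d) (y : Y) : ℝ := ∫ z, q.w y z * lik t z ∂stdGaussian (Vec d)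

/-- The conditional mean of an `N(0, I)` observation given the symbol `y`; it is `0` if `y` has
probability `0`. -/
def mean (y : Y) : Vec d := (q.prob y)⁻¹ • ∫ z, q.w y z • z ∂stdGaussian (Vec d)

theorem w_le_one (y : Y) (z : Vec d) : q.w y z ≤ 1 := by
  rw [← q.sum_eq_one z]
  exact Finset.single_le_sum (f := fun y => q.w y z) (fun i _ => q.nonneg i z) (Finset.mem_univ y)

theorem integrable_w_mul (y : Y) {φ : Vec d → ℝ} (hφ : Integrable φ (stdGaussian (Vec d))) :
    Integrable (fun z => q.w y z * φ z) (stdGaussian (Vec d)) :=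
  hφ.bdd_mul (c := 1) (q.measurable_w y).aestronglyMeasurable
    (.of_forall fun z => by
      rw [Real.norm_of_nonneg (q.nonneg y z)]; exact q.w_le_one y z)

theorem integrable_w (y : Y) : Integrable (q.w y) (stdGaussian (Vec d)) := by
  simpa using q.integrable_w_mul y (integrable_const (1 : ℝ))

theorem sum_integral_w_mul {φ : Vec d → ℝ} (hφ : Integrable φ (stdGaussian (Vec d))) :
    ∑ y, ∫ z, q.w y z * φ z ∂stdGaussian (Vec d) = ∫ z, φ z ∂stdGaussian (Vec d) := by
  rw [← integral_finsetSum _ fun y _ => q.integrable_w_mul y hφ]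
  simp_rw [← Finset.sum_mul, q.sum_eq_one, one_mul]

theorem prob_nonneg (y : Y) : 0 ≤ q.prob y := integral_nonneg (q.nonneg y)

theorem sum_prob : ∑ y, q.prob y = 1 := by
  simpa [prob] using q.sum_integral_w_mul (integrable_const (1 : ℝ))

theorem probAt_nonneg (t : Vec d) (y : Y) : 0 ≤ q.probAt t y :=
  integral_nonneg fun z => mul_nonneg (q.nonneg y z) (lik_pos t z).le

theorem sum_probAt (t : Vec d) : ∑ y, q.probAt t y = 1 := by
  rw [← integral_lik t, ← q.sum_integral_w_mul (integrable_lik t)]; rfl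

theorem integral_w_mul_eq_zero {y : Y} (hy : q.prob y = 0) (φ : Vec d → ℝ) :
    ∫ z, q.w y z * φ z ∂stdGaussian (Vec d) = 0 := by
  have h := (integral_eq_zero_iff_of_nonneg (q.nonneg y) (q.integrable_w y)).1 hy
  refine integral_eq_zero_of_ae ?_
  filter_upwards [h] with z hz
  simp [hz]

theorem probAt_eq_zero {y : Y} (hy : q.prob y = 0) (t : Vec d) : q.probAt t y = 0 :=
  q.integral_w_mul_eq_zero hy _

/-- Conditioning on the symbol contracts the `L²` norm. -/
theorem sum_sq_integral_div_le {φ : Vec d → ℝ} (hφ : MemLp φ 2 (stdGaussian (Vec d))) :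
    ∑ y, (∫ z, q.w y z * φ z ∂stdGaussian (Vec d)) ^ 2 / q.prob y ≤
      ∫ z, φ z ^ 2 ∂stdGaussian (Vec d) := by
  have h1 : Integrable φ (stdGaussian (Vec d)) := hφ.integrable (by norm_num)
  have h2 : Integrable (fun z => φ z ^ 2) (stdGaussian (Vec d)) := hφ.integrable_sq
  rw [← q.sum_integral_w_mul h2]
  refine Finset.sum_le_sum fun y _ => ?_
  set I := ∫ z, q.w y z * φ z ∂stdGaussian (Vec d) with hI
  rcases eq_or_ne (q.prob y) 0 with hy | hy
  · rw [hy, div_zero]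
    exact integral_nonneg fun z => mul_nonneg (q.nonneg y z) (sq_nonneg _)
  have h3 : 0 ≤ ∫ z, q.w y z * (φ z - I / q.prob y) ^ 2 ∂stdGaussian (Vec d) :=
    integral_nonneg fun z => mul_nonneg (q.nonneg y z) (sq_nonneg _)
  have h4 : ∀ z, q.w y z * (φ z - I / q.prob y) ^ 2 =
      q.w y z * φ z ^ 2 - 2 * (I / q.prob y) * (q.w y z * φ z) +
        (I / q.prob y) ^ 2 * q.w y z := fun z => by ring
  simp_rw [h4] at h3
  have hw1 := q.integrable_w_mul y h1
  have hw2 := q.integrable_w_mul y h2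
  have hw0 := q.integrable_w y
  rw [integral_add (by fun_prop) (by fun_prop), integral_sub (by fun_prop) (by fun_prop),
    integral_const_mul, integral_const_mul, ← hI] at h3
  have h5 : (∫ z, q.w y z ∂stdGaussian (Vec d)) = q.prob y := rfl
  rw [h5] at h3
  have h6 : 2 * (I / q.prob y) * I - (I / q.prob y) ^ 2 * q.prob y = I ^ 2 / q.prob y := by
    field_simp; ring
  linarith

theorem integral_w_mul_inner (y : Y) (v : Vec d) :
    ∫ z, q.w y z * inner ℝ v z ∂stdGaussian (Vec d) = q.prob y * inner ℝ v (q.mean y) := by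
  rcases eq_or_ne (q.prob y) 0 with hy | hy
  · rw [q.integral_w_mul_eq_zero hy, hy, zero_mul]
  have hint : Integrable (fun z => q.w y z • z) (stdGaussian (Vec d)) :=
    Integrable.bdd_smul (IsGaussian.integrable_id (μ := stdGaussian (Vec d))) 1
      (q.measurable_w y).aestronglyMeasurable
      (.of_forall fun z => by
        rw [Real.norm_of_nonneg (q.nonneg y z)]; exact q.w_le_one y z)
  rw [mean, real_inner_smul_right, ← integral_inner hint, mul_inv_cancel_left₀ hy]
  simp_rw [real_inner_smul_right]

theorem sum_prob_mul_inner_mean_sq_le (v : Vec d) :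
    ∑ y, q.prob y * inner ℝ v (q.mean y) ^ 2 ≤ ‖v‖ ^ 2 := by
  have h := q.sum_sq_integral_div_le (memLp_inner v)
  simp_rw [sq (inner ℝ v _), integral_inner_mul_inner, real_inner_self_eq_norm_sq,
    integral_w_mul_inner] at h
  refine le_trans (Finset.sum_le_sum fun y _ => ?_) h
  rcases eq_or_ne (q.prob y) 0 with hy | hy
  · simp [hy]
  · apply le_of_eq; field_simp

/-- The trace `∑_y p_y ‖μ_y‖²` of the covariance of the conditional mean. -/
def energy : ℝ := ∑ y, q.prob y * ‖q.mean y‖ ^ 2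

theorem energy_nonneg : 0 ≤ q.energy :=
  Finset.sum_nonneg fun y _ => mul_nonneg (q.prob_nonneg y) (sq_nonneg _)

theorem energy_le_dim : q.energy ≤ d := by
  have h : ∀ y, ‖q.mean y‖ ^ 2 = ∑ i, inner ℝ (EuclideanSpace.basisFun (Fin d) ℝ i) (q.mean y) ^ 2 :=
    fun y => ((EuclideanSpace.basisFun (Fin d) ℝ).sum_sq_inner_right _).symm
  simp_rw [energy, h, Finset.mul_sum]
  rw [Finset.sum_comm]
  refine (Finset.sum_le_sum fun i _ => q.sum_prob_mul_inner_mean_sq_le _).trans ?_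
  simp

/-- A symbol of probability `p` has conditional mean of squared norm at most `2 log (1 / p)`. -/
theorem norm_mean_sq_le {y : Y} (hy : q.prob y ≠ 0) :
    ‖q.mean y‖ ^ 2 ≤ -2 * Real.log (q.prob y) := by
  have hp : 0 < q.prob y := (q.prob_nonneg y).lt_of_ne' hy
  set v := q.mean y with hv
  set c := ‖v‖ ^ 2 with hc
  -- the tangent line inequality for `exp` at `c`, which is the conditional mean of `⟪v, z⟫`
  have h1 : ∀ z : Vec d, q.w y z * (1 - c) + q.w y z * inner ℝ v z ≤
      Real.exp (-c / 2) * lik v z := by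
    intro z
    have h2 := Real.add_one_le_exp (inner ℝ v z - c)
    have h3 : Real.exp (-c / 2) * lik v z = Real.exp (inner ℝ v z - c) := by
      rw [lik, ← Real.exp_add]; congr 1; ring
    rw [h3, ← mul_add]
    calc q.w y z * (1 - c + inner ℝ v z) ≤ q.w y z * Real.exp (inner ℝ v z - c) :=
          mul_le_mul_of_nonneg_left (by linarith) (q.nonneg y z)
      _ ≤ 1 * Real.exp (inner ℝ v z - c) :=
          mul_le_mul_of_nonneg_right (q.w_le_one y z) (Real.exp_pos _).le
      _ = _ := one_mul _
  have hi : Integrable (fun z : Vec d => inner ℝ v z) (stdGaussian (Vec d)) :=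
    (memLp_inner v).integrable (by norm_num)
  have h2 := integral_mono (((q.integrable_w y).mul_const (1 - c)).add (q.integrable_w_mul y hi))
    ((integrable_lik v).const_mul (Real.exp (-c / 2))) h1
  simp only [Pi.add_apply] at h2
  rw [integral_add ((q.integrable_w y).mul_const _) (q.integrable_w_mul y hi), integral_mul_const,
    integral_w_mul_inner, integral_const_mul, integral_lik, ← hv, real_inner_self_eq_norm_sq] at h2
  have h3 : q.prob y ≤ Real.exp (-c / 2) := by
    have h5 : (∫ z, q.w y z ∂stdGaussian (Vec d)) = q.prob y := rfl
    rw [h5] at h2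
    linarith
  have h4 := (Real.log_le_iff_le_exp hp).2 h3
  linarith

/-- The conditional mean carries at most twice the entropy of the symbol, hence at most
`2 log |Y|`. -/
theorem energy_le_log_card : q.energy ≤ 2 * Real.log (Fintype.card Y) := by
  have hY : Nonempty Y := by
    by_contra h
    rw [not_nonempty_iff] at h
    simpa using q.sum_eq_one 0
  have hN : (0 : ℝ) < Fintype.card Y := by exact_mod_cast Fintype.card_pos
  have h : ∀ y, q.prob y * ‖q.mean y‖ ^ 2 ≤
      2 * (q.prob y * Real.log (Fintype.card Y) + (1 / Fintype.card Y - q.prob y)) := by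
    intro y
    rcases eq_or_ne (q.prob y) 0 with hy | hy
    · rw [hy]; simp
    have hp : 0 < q.prob y := (q.prob_nonneg y).lt_of_ne' hy
    have h1 := q.norm_mean_sq_le hy
    have h2 := Real.log_le_sub_one_of_pos (x := 1 / (Fintype.card Y * q.prob y)) (by positivity)
    rw [one_div, Real.log_inv, Real.log_mul hN.ne' hy] at h2
    have h3 : q.prob y * ((Fintype.card Y * q.prob y : ℝ)⁻¹) = 1 / Fintype.card Y := by
      field_simp
    nlinarith
  refine (Finset.sum_le_sum fun y _ => h y).trans ?_
  rw [← Finset.mul_sum, Finset.sum_add_distrib, ← Finset.sum_mul, Finset.sum_sub_distrib, sum_prob]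
  simp

/-- The chi-square kernel `∑_y P_s(y) P_t(y) / P_0(y)` of the quantized observation. -/
def chiKernel (s t : Vec d) : ℝ := ∑ y, q.probAt s y * q.probAt t y / q.prob y

/-- The information kernel `⟪s, F t⟫`, with `F` the covariance of the conditional mean. -/
def infoKernel (s t : Vec d) : ℝ :=
  ∑ y, q.prob y * (inner ℝ s (q.mean y) * inner ℝ t (q.mean y))

/-- The quadratic form inequality `G ≤ 1 + 2 ⟪s, F t⟫ + 2 (exp ⟪s, t⟫ - 1 - ⟪s, t⟫)` for the
chi-square kernel `G`. The last term is the second moment of the part of the likelihood ratio of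
order at least two, and conditioning on the symbol can only decrease it. -/
theorem sum_sum_mul_chiKernel_le {I : Type*} [Fintype I] (t : I → Vec d) (c : I → ℝ) :
    ∑ i, ∑ j, c i * c j * q.chiKernel (t i) (t j) ≤
      ∑ i, ∑ j, c i * c j * (1 + 2 * q.infoKernel (t i) (t j) +
        2 * (Real.exp (inner ℝ (t i) (t j)) - 1 - inner ℝ (t i) (t j))) := by
  classical
  have hsq : ∀ a : I → ℝ, ∑ i, ∑ j, c i * c j * (a i * a j) = (∑ i, c i * a i) ^ 2 := by
    intro a
    rw [sq, Finset.sum_mul_sum]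
    exact Finset.sum_congr rfl fun i _ => Finset.sum_congr rfl fun j _ => by ring
  set γ := stdGaussian (Vec d)
  -- the part of `∑ c_i L_{t_i}` of order at least two
  let Q : Vec d → ℝ := fun z => ∑ i, c i * (lik (t i) z - 1 - inner ℝ (t i) z)
  have hq : ∀ i, MemLp (fun z => lik (t i) z - 1 - inner ℝ (t i) z) 2 γ := fun i =>
    ((memLp_lik (t i)).sub (memLp_const 1)).sub (memLp_inner (t i))
  have hQ : MemLp Q 2 γ := memLp_finsetSum _ fun i _ => (hq i).const_mul (c i)
  have hq1 : ∀ i, Integrable (fun z => lik (t i) z - 1 - inner ℝ (t i) z) γ := fun i =>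
    (hq i).integrable (by norm_num)
  have hL : ∀ i, Integrable (lik (t i)) γ := fun i => integrable_lik _
  have hG : ∀ i, Integrable (fun z => inner ℝ (t i) z) γ := fun i =>
    (memLp_inner (t i)).integrable (by norm_num)
  have hQ2 : ∫ z, Q z ^ 2 ∂γ = ∑ i, ∑ j, c i * c j *
      (Real.exp (inner ℝ (t i) (t j)) - 1 - inner ℝ (t i) (t j)) := by
    have h1 : ∀ z, Q z ^ 2 = ∑ i, ∑ j, c i * c j * ((lik (t i) z - 1 - inner ℝ (t i) z) *
        (lik (t j) z - 1 - inner ℝ (t j) z)) := fun z => (hsq _).symm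
    simp_rw [h1]
    have hqq : ∀ i j, Integrable (fun z => (lik (t i) z - 1 - inner ℝ (t i) z) *
        (lik (t j) z - 1 - inner ℝ (t j) z)) γ := fun i j => (hq i).integrable_mul (hq j)
    rw [integral_finsetSum _ fun i _ => integrable_finsetSum _ fun j _ => (hqq i j).const_mul _]
    refine Finset.sum_congr rfl fun i _ => ?_
    rw [integral_finsetSum _ fun j _ => (hqq i j).const_mul _]
    refine Finset.sum_congr rfl fun j _ => ?_
    rw [integral_const_mul]
    congr 1
    have hLi := hL i
    have hLj := hL j
    have hGi := hG i
    have hGj := hG j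
    have hLL : Integrable (fun z => lik (t i) z * lik (t j) z) γ :=
      (memLp_lik (t i)).integrable_mul (memLp_lik (t j))
    have hGL : Integrable (fun z => inner ℝ (t i) z * lik (t j) z) γ :=
      (memLp_inner (t i)).integrable_mul (memLp_lik (t j))
    have hLG : Integrable (fun z => inner ℝ (t j) z * lik (t i) z) γ :=
      (memLp_inner (t j)).integrable_mul (memLp_lik (t i))
    have hGG : Integrable (fun z => inner ℝ (t i) z * inner ℝ (t j) z) γ :=
      (memLp_inner (t i)).integrable_mul (memLp_inner (t j))
    have h2 : ∀ z, (lik (t i) z - 1 - inner ℝ (t i) z) * (lik (t j) z - 1 - inner ℝ (t j) z) =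
        lik (t i) z * lik (t j) z - inner ℝ (t i) z * lik (t j) z -
        inner ℝ (t j) z * lik (t i) z + inner ℝ (t i) z * inner ℝ (t j) z -
        lik (t i) z - lik (t j) z + inner ℝ (t i) z + inner ℝ (t j) z + 1 := fun z => by ring
    simp_rw [h2]
    rw [integral_add, integral_add, integral_add, integral_sub, integral_sub, integral_add,
      integral_sub, integral_sub, integral_lik_mul_lik, integral_inner_mul_lik,
      integral_inner_mul_lik, integral_inner_mul_inner, integral_lik, integral_lik,
      integral_inner_stdGaussian, integral_inner_stdGaussian,
      real_inner_comm (t i) (t j)]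
    · simp; ring
    all_goals fun_prop
  have hbessel := q.sum_sq_integral_div_le hQ
  rw [hQ2] at hbessel
  have hprobAt : ∀ y, ∑ i, c i * q.probAt (t i) y = q.prob y * ∑ i, c i +
      q.prob y * ∑ i, c i * inner ℝ (t i) (q.mean y) + ∫ z, q.w y z * Q z ∂γ := by
    intro y
    have h1 : ∀ z, q.w y z * Q z = ∑ i, c i * (q.w y z * (lik (t i) z - 1 - inner ℝ (t i) z)) := by
      intro z
      rw [Finset.mul_sum]
      exact Finset.sum_congr rfl fun i _ => by ring
    simp_rw [h1]
    rw [integral_finsetSum _ fun i _ => (q.integrable_w_mul y (hq1 i)).const_mul _,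
      Finset.mul_sum, Finset.mul_sum, ← Finset.sum_add_distrib, ← Finset.sum_add_distrib]
    refine Finset.sum_congr rfl fun i _ => ?_
    rw [integral_const_mul]
    simp_rw [mul_sub, mul_one]
    rw [integral_sub, integral_sub, integral_w_mul_inner]
    · simp only [probAt, prob]; ring
    · exact q.integrable_w_mul y (hL i)
    · exact q.integrable_w y
    · exact (q.integrable_w_mul y (hL i)).sub (q.integrable_w y)
    · exact q.integrable_w_mul y (hG i)
  have hchi : ∑ i, ∑ j, c i * c j * q.chiKernel (t i) (t j) =
      ∑ y, (∑ i, c i * q.probAt (t i) y) ^ 2 / q.prob y := by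
    simp_rw [← hsq, chiKernel, Finset.mul_sum, Finset.sum_div]
    simp_rw [Finset.sum_comm (s := Finset.univ (α := I)) (t := Finset.univ (α := Y)), mul_div_assoc]
  have hinfo : ∑ i, ∑ j, c i * c j * q.infoKernel (t i) (t j) =
      ∑ y, q.prob y * (∑ i, c i * inner ℝ (t i) (q.mean y)) ^ 2 := by
    simp_rw [← hsq, infoKernel, Finset.mul_sum]
    simp_rw [Finset.sum_comm (s := Finset.univ (α := I)) (t := Finset.univ (α := Y))]
    refine Finset.sum_congr rfl fun y _ => Finset.sum_congr rfl fun i _ =>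
      Finset.sum_congr rfl fun j _ => by ring
  -- the first and higher order parts together have conditional means that average to zero
  have hcentre : ∑ y, (q.prob y * ∑ i, c i * inner ℝ (t i) (q.mean y) +
      ∫ z, q.w y z * Q z ∂γ) = 0 := by
    have h1 := Finset.sum_congr (s₁ := Finset.univ) rfl fun y _ => hprobAt y
    rw [Finset.sum_comm] at h1
    simp_rw [← Finset.mul_sum, sum_probAt, add_assoc, mul_one] at h1
    rw [Finset.sum_add_distrib, ← Finset.sum_mul, sum_prob] at h1
    linarith
  have hterm : ∀ y, (∑ i, c i * q.probAt (t i) y) ^ 2 / q.prob y ≤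
      q.prob y * (∑ i, c i) ^ 2 + 2 * (∑ i, c i) *
        (q.prob y * ∑ i, c i * inner ℝ (t i) (q.mean y) + ∫ z, q.w y z * Q z ∂γ) +
      2 * (q.prob y * (∑ i, c i * inner ℝ (t i) (q.mean y)) ^ 2) +
      2 * ((∫ z, q.w y z * Q z ∂γ) ^ 2 / q.prob y) := by
    intro y
    rw [hprobAt y]
    rcases eq_or_ne (q.prob y) 0 with hy | hy
    · rw [q.integral_w_mul_eq_zero hy, hy]; simp
    have hp : 0 < q.prob y := (q.prob_nonneg y).lt_of_ne' hy
    set a := ∑ i, c i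
    set b := ∑ i, c i * inner ℝ (t i) (q.mean y)
    set e := ∫ z, q.w y z * Q z ∂γ
    set p := q.prob y
    have h1 : (p * a ^ 2 + 2 * a * (p * b + e) + 2 * (p * b ^ 2) + 2 * (e ^ 2 / p)) -
        (p * a + p * b + e) ^ 2 / p = (p * b - e) ^ 2 / p := by
      field_simp; ring
    have h2 : 0 ≤ (p * b - e) ^ 2 / p := by positivity
    linarith
  rw [hchi]
  refine (Finset.sum_le_sum fun y _ => hterm y).trans ?_
  have hone : ∑ i, ∑ j, c i * c j = (∑ i, c i) ^ 2 := by simpa using hsq fun _ => 1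
  have hrhs : ∑ i, ∑ j, c i * c j * (1 + 2 * q.infoKernel (t i) (t j) +
        2 * (Real.exp (inner ℝ (t i) (t j)) - 1 - inner ℝ (t i) (t j))) =
      (∑ i, c i) ^ 2 + 2 * (∑ i, ∑ j, c i * c j * q.infoKernel (t i) (t j)) +
      2 * ∑ i, ∑ j, c i * c j *
        (Real.exp (inner ℝ (t i) (t j)) - 1 - inner ℝ (t i) (t j)) := by
    rw [← hone]
    simp_rw [Finset.mul_sum, ← Finset.sum_add_distrib]
    exact Finset.sum_congr rfl fun i _ => Finset.sum_congr rfl fun j _ => by ring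
  rw [hrhs, hinfo]
  rw [Finset.sum_add_distrib, Finset.sum_add_distrib, Finset.sum_add_distrib, ← Finset.mul_sum,
    ← Finset.mul_sum, ← Finset.mul_sum, ← Finset.sum_mul, sum_prob, hcentre]
  linarith

end Quantizer

/-! ### Entrywise operations on positive semidefinite kernels -/

section PosSemidef

variable {I : Type*}

theorem posSemidef_mul {K L : I → I → ℝ} (hK : (Matrix.of K).PosSemidef)
    (hL : (Matrix.of L).PosSemidef) : (Matrix.of fun i j => K i j * L i j).PosSemidef :=
  hK.hadamard hL

theorem posSemidef_add {K L : I → I → ℝ} (hK : (Matrix.of K).PosSemidef)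
    (hL : (Matrix.of L).PosSemidef) : (Matrix.of fun i j => K i j + L i j).PosSemidef :=
  hK.add hL

theorem posSemidef_const_mul {K : I → I → ℝ} (hK : (Matrix.of K).PosSemidef) {a : ℝ}
    (ha : 0 ≤ a) : (Matrix.of fun i j => a * K i j).PosSemidef :=
  hK.smul ha

variable [Fintype I]

theorem posSemidef_of_sum_nonneg {K : I → I → ℝ} (hsymm : ∀ i j, K i j = K j i)
    (h : ∀ c : I → ℝ, 0 ≤ ∑ i, ∑ j, c i * c j * K i j) : (Matrix.of K).PosSemidef := by
  refine Matrix.PosSemidef.of_dotProduct_mulVec_nonneg ?_ fun c => ?_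
  · ext i j; simp [hsymm i j]
  · refine (h c).trans_eq ?_
    simp only [dotProduct, Matrix.mulVec, Matrix.of_apply, star_trivial, Finset.mul_sum]
    exact Finset.sum_congr rfl fun i _ => Finset.sum_congr rfl fun j _ => by ring

theorem sum_nonneg_of_posSemidef {K : I → I → ℝ} (hK : (Matrix.of K).PosSemidef) (c : I → ℝ) :
    0 ≤ ∑ i, ∑ j, c i * c j * K i j := by
  refine (hK.dotProduct_mulVec_nonneg c).trans_eq ?_
  simp only [dotProduct, Matrix.mulVec, Matrix.of_apply, star_trivial, Finset.mul_sum]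
  exact Finset.sum_congr rfl fun i _ => Finset.sum_congr rfl fun j _ => by ring

theorem posSemidef_one : (Matrix.of fun _ _ : I => (1 : ℝ)).PosSemidef :=
  posSemidef_of_sum_nonneg (fun _ _ => rfl) fun c => by
    simp_rw [mul_one, ← Finset.sum_mul_sum]
    exact mul_self_nonneg _

theorem posSemidef_pow {K : I → I → ℝ} (hK : (Matrix.of K).PosSemidef) (n : ℕ) :
    (Matrix.of fun i j => K i j ^ n).PosSemidef := by
  induction n with
  | zero => simpa using posSemidef_one
  | succ n ih => simpa only [pow_succ] using posSemidef_mul ih hK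

/-- The exponential series without its first two terms has nonnegative coefficients, so it
preserves positive semidefiniteness when applied entrywise. -/
theorem posSemidef_exp_sub {K : I → I → ℝ} (hK : (Matrix.of K).PosSemidef) :
    (Matrix.of fun i j => Real.exp (K i j) - 1 - K i j).PosSemidef := by
  refine posSemidef_of_sum_nonneg (fun i j => ?_) fun c => ?_
  · have h : K i j = K j i := by simpa using (hK.isHermitian.apply i j).symm
    rw [h]
  · have hs : ∀ x : ℝ, HasSum (fun n : ℕ => x ^ (n + 2) / (n + 2).factorial)
        (Real.exp x - 1 - x) := by
      intro x
      have h := NormedSpace.expSeries_div_hasSum_exp x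
      rw [← Real.exp_eq_exp_ℝ, ← hasSum_nat_add_iff' 2] at h
      simpa [Finset.sum_range_succ, sub_sub] using h
    refine HasSum.nonneg (fun n => ?_)
      (hasSum_sum fun i _ => hasSum_sum fun j _ => (hs (K i j)).mul_left (c i * c j))
    have h := mul_nonneg (sum_nonneg_of_posSemidef (posSemidef_pow hK (n + 2)) c)
      (inv_nonneg.2 (Nat.cast_nonneg (α := ℝ) (n + 2).factorial))
    refine h.trans_eq ?_
    simp_rw [Finset.sum_mul, div_eq_mul_inv, mul_assoc]

theorem posSemidef_exp_sub_one {K : I → I → ℝ} (hK : (Matrix.of K).PosSemidef) :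
    (Matrix.of fun i j => Real.exp (K i j) - 1).PosSemidef := by
  simpa using posSemidef_add (posSemidef_exp_sub hK) hK

/-- Entrywise products are monotone for the Loewner order on positive semidefinite kernels. -/
theorem posSemidef_prod_sub_prod {J : Type*} (s : Finset J) {K L : J → I → I → ℝ}
    (hK : ∀ j, (Matrix.of (K j)).PosSemidef)
    (hL : ∀ j, (Matrix.of fun i i' => L j i i' - K j i i').PosSemidef) :
    (Matrix.of fun i i' => ∏ j ∈ s, K j i i').PosSemidef ∧
      (Matrix.of fun i i' => ∏ j ∈ s, L j i i' - ∏ j ∈ s, K j i i').PosSemidef := by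
  classical
  induction s using Finset.induction_on with
  | empty => exact ⟨by simpa using posSemidef_one, by
      simp only [Finset.prod_empty, sub_self]; exact Matrix.PosSemidef.zero⟩
  | insert j s hj ih =>
    simp only [Finset.prod_insert hj]
    refine ⟨posSemidef_mul (hK j) ih.1, ?_⟩
    have h1 := posSemidef_add (hK j) (hL j)
    convert posSemidef_add (posSemidef_mul h1 ih.2) (posSemidef_mul (hL j) ih.1) using 4
    ring

end PosSemidef

/-! ### Comparison of the chi-square kernel of several machines -/

section Comparison

variable {d : ℕ} {I : Type*} [Fintype I]

theorem posSemidef_inner (t : I → Vec d) :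
    (Matrix.of fun i j => (inner ℝ (t i) (t j) : ℝ)).PosSemidef := by
  refine posSemidef_of_sum_nonneg (fun i j => real_inner_comm _ _) fun c => ?_
  have h : ∑ i, ∑ j, c i * c j * (inner ℝ (t i) (t j) : ℝ) =
      inner ℝ (∑ i, c i • t i) (∑ i, c i • t i) := by
    simp_rw [sum_inner, inner_sum, real_inner_smul_left, real_inner_smul_right, mul_assoc]
  rw [h]
  exact real_inner_self_nonneg

variable {Y : Type*} [Fintype Y] (q : Quantizer d Y)

theorem Quantizer.posSemidef_infoKernel (t : I → Vec d) :
    (Matrix.of fun i j => q.infoKernel (t i) (t j)).PosSemidef := by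
  refine posSemidef_of_sum_nonneg (fun i j => ?_) fun c => ?_
  · simp only [infoKernel, mul_comm (inner ℝ (t i) _ : ℝ)]
  · have h : ∑ i, ∑ j, c i * c j * q.infoKernel (t i) (t j) =
        ∑ y, q.prob y * (∑ i, c i * inner ℝ (t i) (q.mean y)) ^ 2 := by
      simp_rw [infoKernel, sq, Finset.sum_mul_sum, Finset.mul_sum]
      simp_rw [Finset.sum_comm (s := Finset.univ (α := I)) (t := Finset.univ (α := Y))]
      refine Finset.sum_congr rfl fun y _ => Finset.sum_congr rfl fun i _ =>
        Finset.sum_congr rfl fun j _ => by ring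
    rw [h]
    exact Finset.sum_nonneg fun y _ => mul_nonneg (q.prob_nonneg y) (sq_nonneg _)

theorem Quantizer.posSemidef_chiKernel (t : I → Vec d) :
    (Matrix.of fun i j => q.chiKernel (t i) (t j)).PosSemidef := by
  refine posSemidef_of_sum_nonneg (fun i j => ?_) fun c => ?_
  · simp only [chiKernel, mul_comm (q.probAt (t i) _)]
  · have h : ∑ i, ∑ j, c i * c j * q.chiKernel (t i) (t j) =
        ∑ y, (∑ i, c i * q.probAt (t i) y) ^ 2 / q.prob y := by
      simp_rw [chiKernel, sq, Finset.sum_mul_sum, Finset.mul_sum, Finset.sum_div]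
      simp_rw [Finset.sum_comm (s := Finset.univ (α := I)) (t := Finset.univ (α := Y))]
      refine Finset.sum_congr rfl fun y _ => Finset.sum_congr rfl fun i _ =>
        Finset.sum_congr rfl fun j _ => by ring
    rw [h]
    exact Finset.sum_nonneg fun y _ => div_nonneg (sq_nonneg _) (q.prob_nonneg y)

/-- In the Loewner order, the chi-square kernel of one machine is at most
`exp (2 ⟪s, F t⟫) (1 + 2 (exp ⟪s, t⟫ - 1 - ⟪s, t⟫))`: the constraint acts on the first order part
only, the higher order part is bounded by its value for the unquantized observation. -/
theorem Quantizer.posSemidef_sub_chiKernel (t : I → Vec d) :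
    (Matrix.of fun i j => Real.exp (2 * q.infoKernel (t i) (t j)) *
      (1 + 2 * (Real.exp (inner ℝ (t i) (t j)) - 1 - inner ℝ (t i) (t j))) -
        q.chiKernel (t i) (t j)).PosSemidef := by
  have h1 : (Matrix.of fun i j => (1 + 2 * q.infoKernel (t i) (t j) +
      2 * (Real.exp (inner ℝ (t i) (t j)) - 1 - inner ℝ (t i) (t j))) -
        q.chiKernel (t i) (t j)).PosSemidef := by
    refine posSemidef_of_sum_nonneg (fun i j => ?_) fun c => ?_
    · have h2 : q.infoKernel (t i) (t j) = q.infoKernel (t j) (t i) := by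
        simp only [infoKernel, mul_comm (inner ℝ (t i) _ : ℝ)]
      have h3 : q.chiKernel (t i) (t j) = q.chiKernel (t j) (t i) := by
        simp only [chiKernel, mul_comm (q.probAt (t i) _)]
      rw [h2, h3, real_inner_comm]
    · simp_rw [mul_sub _ _ (q.chiKernel _ _), Finset.sum_sub_distrib]
      exact sub_nonneg.2 (q.sum_sum_mul_chiKernel_le t c)
  have hx := posSemidef_const_mul (q.posSemidef_infoKernel t) zero_le_two
  have hh := posSemidef_const_mul (posSemidef_exp_sub (posSemidef_inner t)) zero_le_two
  have h2 := posSemidef_add (posSemidef_exp_sub hx) (posSemidef_mul (posSemidef_exp_sub_one hx) hh)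
  convert posSemidef_add h1 h2 using 4
  ring

theorem exp_le_add_exp_sq (x : ℝ) : Real.exp x ≤ x + Real.exp (x ^ 2) := by
  have h := Real.add_one_le_exp (x ^ 2)
  rcases le_or_gt |x| 1 with hx | hx
  · have := (abs_le.1 (Real.abs_exp_sub_one_sub_id_le hx)).2
    linarith
  · rcases lt_abs.1 hx with hx | hx
    · have : Real.exp x ≤ Real.exp (x ^ 2) := Real.exp_le_exp.2 (by nlinarith)
      linarith
    · have : Real.exp x ≤ 1 := Real.exp_le_one_iff.2 (by linarith)
      nlinarith

theorem one_add_two_mul_exp_sub_le (s : ℝ) :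
    1 + 2 * (Real.exp s - 1 - s) ≤ Real.exp (2 * s ^ 2) := by
  have h1 := exp_le_add_exp_sq s
  have h2 : Real.exp (2 * s ^ 2) = Real.exp (s ^ 2) ^ 2 := by
    rw [← Real.exp_nat_mul]; simp
  nlinarith [sq_nonneg (Real.exp (s ^ 2) - 1)]

/-- The second moment of the likelihood ratio of all the transcripts, under a uniform prior on the
points `t i`. -/
theorem sum_sum_prod_chiKernel_le {m : ℕ} {Y : Fin m → Type*} [∀ j, Fintype (Y j)]
    (q : ∀ j, Quantizer d (Y j)) (t : I → Vec d) :
    ∑ i, ∑ i', ∏ j, (q j).chiKernel (t i) (t i') ≤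
      ∑ i, ∑ i', Real.exp (2 * ∑ j, (q j).infoKernel (t i) (t i')) *
        Real.exp (2 * m * inner ℝ (t i) (t i') ^ 2) := by
  have h := sum_nonneg_of_posSemidef (posSemidef_prod_sub_prod Finset.univ
    (fun j => (q j).posSemidef_chiKernel t) (fun j => (q j).posSemidef_sub_chiKernel t)).2
    (fun _ => 1)
  simp only [one_mul, Finset.sum_sub_distrib, sub_nonneg] at h
  refine h.trans (Finset.sum_le_sum fun i _ => Finset.sum_le_sum fun i' _ => ?_)
  rw [Finset.prod_mul_distrib, ← Real.exp_sum, ← Finset.mul_sum, Finset.prod_const,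
    Finset.card_univ, Fintype.card_fin]
  refine mul_le_mul_of_nonneg_left ?_ (Real.exp_pos _).le
  have h1 : 0 ≤ 1 + 2 * (Real.exp (inner ℝ (t i) (t i')) - 1 - inner ℝ (t i) (t i')) := by
    have := Real.add_one_le_exp (inner ℝ (t i) (t i'))
    linarith
  refine (pow_le_pow_left₀ h1 (one_add_two_mul_exp_sub_le _) m).trans_eq ?_
  rw [← Real.exp_nat_mul]
  congr 1; ring

end Comparison

/-! ### Exponential moments of Rademacher sums -/

section Rademacher

open scoped BigOperators

/-- The two signs, indexed by `Bool`; a uniform point of `ι → Bool` encodes independent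
Rademacher variables. -/
def sgn (b : Bool) : ℝ := if b then 1 else -1

@[simp] theorem sgn_sq (b : Bool) : sgn b ^ 2 = 1 := by cases b <;> simp [sgn]

variable {ι : Type*} [Fintype ι] [DecidableEq ι]

theorem expect_exp_sum_mul_sgn_le (u : ι → ℝ) :
    𝔼 ε : ι → Bool, Real.exp (∑ i, u i * sgn (ε i)) ≤ Real.exp ((∑ i, u i ^ 2) / 2) := by
  have h : ∑ ε : ι → Bool, Real.exp (∑ i, u i * sgn (ε i)) = ∏ i, (2 * Real.cosh (u i)) := by
    have h1 := Finset.prod_univ_sum (fun _ : ι => (Finset.univ : Finset Bool))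
      (fun i b => Real.exp (u i * sgn b))
    simp_rw [Real.exp_sum]
    rw [Fintype.piFinset_univ] at h1
    rw [← h1]
    refine Finset.prod_congr rfl fun i _ => ?_
    simp [sgn, Real.cosh_eq]; ring
  rw [Fintype.expect_eq_sum_div_card, h, Finset.prod_mul_distrib]
  simp only [Finset.prod_const, Finset.card_univ, Fintype.card_pi, Fintype.card_bool, Nat.cast_pow,
    Nat.cast_ofNat]
  rw [mul_div_cancel_left₀ _ (by positivity), Finset.sum_div, Real.exp_sum]
  exact Finset.prod_le_prod (fun i _ => (Real.cosh_pos _).le) fun i _ => Real.cosh_le_exp_half_sq _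

theorem integrable_exp_mul_sq_gaussianReal {b : ℝ} (hb : 2 * b < 1) :
    Integrable (fun x => Real.exp (b * x ^ 2)) (gaussianReal 0 1) ∧
      ∫ x, Real.exp (b * x ^ 2) ∂gaussianReal 0 1 = 1 / √(1 - 2 * b) := by
  have hpos : 0 < 1 / 2 - b := by linarith
  have h1 : ∀ x : ℝ, gaussianPDFReal 0 1 x * Real.exp (b * x ^ 2) =
      (√(2 * Real.pi))⁻¹ * Real.exp (-(1 / 2 - b) * x ^ 2) := by
    intro x
    simp only [gaussianPDFReal, NNReal.coe_one, mul_one, sub_zero, mul_assoc, ← Real.exp_add]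
    congr 2; ring
  have h2 : ∫ x, Real.exp (b * x ^ 2) ∂gaussianReal 0 1 = 1 / √(1 - 2 * b) := by
    rw [integral_gaussianReal_eq_integral_smul one_ne_zero]
    simp_rw [smul_eq_mul, h1]
    rw [integral_const_mul, integral_gaussian, ← Real.sqrt_inv, ← Real.sqrt_mul (by positivity),
      one_div √_, ← Real.sqrt_inv]
    congr 1
    have : 1 - 2 * b ≠ 0 := by linarith
    have : 1 / 2 - b ≠ 0 := hpos.ne'
    field_simp
  refine ⟨.of_integral_ne_zero ?_, h2⟩
  rw [h2]
  have : 0 < √(1 - 2 * b) := Real.sqrt_pos.2 (by linarith)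
  positivity

/-- The Gaussian linearization `exp (μ y²) = E exp (√(2μ) y g)` reduces the exponential moment of
the square of a Rademacher sum to its Laplace transform. -/
theorem expect_exp_mul_sq_le (u : ι → ℝ) {μ : ℝ} (hμ : 0 ≤ μ) (h : 2 * μ * ∑ i, u i ^ 2 < 1) :
    𝔼 ε : ι → Bool, Real.exp (μ * (∑ i, u i * sgn (ε i)) ^ 2) ≤
      1 / (1 - 2 * μ * ∑ i, u i ^ 2) := by
  have hlin : ∀ y : ℝ, Real.exp (μ * y ^ 2) =
      ∫ g, Real.exp (√(2 * μ) * y * g) ∂gaussianReal 0 1 := by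
    intro y
    have h1 := congrFun (mgf_id_gaussianReal (μ := 0) (v := 1)) (√(2 * μ) * y)
    simp only [mgf, id] at h1
    rw [h1]
    congr 1
    rw [mul_pow, Real.sq_sqrt (by positivity)]
    simp; ring
  have hint : ∀ y : ℝ, Integrable (fun g => Real.exp (√(2 * μ) * y * g)) (gaussianReal 0 1) :=
    fun y => integrable_exp_mul_gaussianReal _
  have hb : 2 * (μ * ∑ i, u i ^ 2) < 1 := by linarith
  obtain ⟨hi, he⟩ := integrable_exp_mul_sq_gaussianReal hb
  simp_rw [hlin]
  have hswap : 𝔼 ε : ι → Bool,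
      ∫ g, Real.exp (√(2 * μ) * (∑ i, u i * sgn (ε i)) * g) ∂gaussianReal 0 1 =
      ∫ g, 𝔼 ε : ι → Bool, Real.exp (√(2 * μ) * (∑ i, u i * sgn (ε i)) * g)
        ∂gaussianReal 0 1 := by
    simp_rw [Fintype.expect_eq_sum_div_card]
    rw [integral_div, integral_finsetSum _ fun ε _ => hint _]
  have hint2 : Integrable (fun g => 𝔼 ε : ι → Bool,
      Real.exp (√(2 * μ) * (∑ i, u i * sgn (ε i)) * g)) (gaussianReal 0 1) := by
    simp_rw [Fintype.expect_eq_sum_div_card]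
    exact (integrable_finsetSum _ fun ε _ => hint _).div_const _
  rw [hswap]
  have hle : ∀ g : ℝ, 𝔼 ε : ι → Bool, Real.exp (√(2 * μ) * (∑ i, u i * sgn (ε i)) * g) ≤
      Real.exp (μ * (∑ i, u i ^ 2) * g ^ 2) := by
    intro g
    have h1 := expect_exp_sum_mul_sgn_le (fun i => √(2 * μ) * u i * g)
    refine le_of_eq_of_le (Finset.expect_congr rfl fun ε _ => ?_) (h1.trans_eq ?_)
    · rw [Finset.mul_sum, Finset.sum_mul]
      congr 1
      exact Finset.sum_congr rfl fun i _ => by ring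
    · simp_rw [mul_pow]
      rw [← Finset.sum_mul, ← Finset.mul_sum, Real.sq_sqrt (by positivity)]
      congr 1; ring
  refine (integral_mono hint2 hi hle).trans ?_
  rw [he, ← mul_assoc]
  have h0 : 0 ≤ ∑ i, u i ^ 2 := Finset.sum_nonneg fun i _ => sq_nonneg _
  have hx : 0 < 1 - 2 * μ * ∑ i, u i ^ 2 := by linarith
  refine one_div_le_one_div_of_le hx (Real.le_sqrt_of_sq_le ?_)
  have : 0 ≤ 2 * μ * ∑ i, u i ^ 2 := by positivity
  nlinarith

/-- Jensen's inequality, with weights proportional to the squared norms of the rows, reduces a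
sum of squares to a single square. -/
theorem expect_exp_mul_sum_sq_le {κ : Type*} [Fintype κ] (A : κ → ι → ℝ) {μ : ℝ} (hμ : 0 ≤ μ)
    (h : 2 * μ * ∑ k, ∑ i, A k i ^ 2 < 1) :
    𝔼 ε : ι → Bool, Real.exp (μ * ∑ k, (∑ i, A k i * sgn (ε i)) ^ 2) ≤
      1 / (1 - 2 * μ * ∑ k, ∑ i, A k i ^ 2) := by
  set S := ∑ k, ∑ i, A k i ^ 2 with hS
  have hrow : ∀ k, 0 ≤ ∑ i, A k i ^ 2 := fun k => Finset.sum_nonneg fun i _ => sq_nonneg _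
  have hzero : ∀ k, ∑ i, A k i ^ 2 = 0 → ∀ i, A k i = 0 := by
    intro k hk i
    exact pow_eq_zero_iff two_ne_zero |>.1
      ((Finset.sum_eq_zero_iff_of_nonneg fun i _ => sq_nonneg _).1 hk i (Finset.mem_univ i))
  have hS0 : 0 ≤ S := Finset.sum_nonneg fun k _ => hrow k
  rcases hS0.eq_or_lt with hS1 | hS1
  · have h1 : ∀ k i, A k i = 0 := fun k => hzero k
      ((Finset.sum_eq_zero_iff_of_nonneg fun k _ => hrow k).1 hS1.symm k (Finset.mem_univ k))
    simp [h1, ← hS1]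
  set w : κ → ℝ := fun k => (∑ i, A k i ^ 2) / S with hw
  have hw0 : ∀ k, 0 ≤ w k := fun k => div_nonneg (hrow k) hS0
  have hw1 : ∑ k, w k = 1 := by
    simp only [hw]; rw [← Finset.sum_div, ← hS, div_self hS1.ne']
  have hJ : ∀ ε : ι → Bool, Real.exp (μ * ∑ k, (∑ i, A k i * sgn (ε i)) ^ 2) ≤
      ∑ k, w k * Real.exp (μ / w k * (∑ i, A k i * sgn (ε i)) ^ 2) := by
    intro ε
    have h1 := convexOn_exp.map_sum_le (t := Finset.univ) (w := w)
      (p := fun k => μ / w k * (∑ i, A k i * sgn (ε i)) ^ 2) (fun k _ => hw0 k) hw1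
      (fun k _ => Set.mem_univ _)
    simp only [smul_eq_mul] at h1
    refine le_of_eq_of_le ?_ h1
    congr 1
    rw [Finset.mul_sum]
    refine Finset.sum_congr rfl fun k _ => ?_
    rcases eq_or_ne (w k) 0 with hk | hk
    · have h2 : ∑ i, A k i ^ 2 = 0 := by
        simpa [hw, hS1.ne'] using hk
      simp [hzero k h2]
    · field_simp
  have hk : ∀ k, w k * 𝔼 ε : ι → Bool, Real.exp (μ / w k * (∑ i, A k i * sgn (ε i)) ^ 2) ≤
      w k * (1 / (1 - 2 * μ * S)) := by
    intro k
    rcases eq_or_ne (w k) 0 with hk | hk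
    · simp [hk]
    refine mul_le_mul_of_nonneg_left ?_ (hw0 k)
    have h2 : ∑ i, A k i ^ 2 = w k * S := by simp only [hw]; field_simp
    have h3 : 2 * (μ / w k) * ∑ i, A k i ^ 2 = 2 * μ * S := by rw [h2]; field_simp
    have h4 := expect_exp_mul_sq_le (A k) (div_nonneg hμ (hw0 k)) (by rw [h3]; exact h)
    rwa [h3] at h4
  calc _ ≤ 𝔼 ε : ι → Bool, ∑ k, w k * Real.exp (μ / w k * (∑ i, A k i * sgn (ε i)) ^ 2) :=
        Finset.expect_le_expect fun ε _ => hJ ε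
    _ = ∑ k, w k * 𝔼 ε : ι → Bool, Real.exp (μ / w k * (∑ i, A k i * sgn (ε i)) ^ 2) := by
        rw [Finset.expect_sum_comm]
        simp_rw [Finset.mul_expect]
    _ ≤ ∑ k, w k * (1 / (1 - 2 * μ * S)) := Finset.sum_le_sum fun k _ => hk k
    _ = _ := by rw [← Finset.sum_mul, hw1, one_mul]

/-- The exponential moment of a decoupled Rademacher chaos of order two. -/
theorem expect_expect_exp_bilin_le (A : ι → ι → ℝ) (h : ∑ i, ∑ j, A i j ^ 2 < 1) :
    𝔼 ε : ι → Bool, 𝔼 ε' : ι → Bool, Real.exp (∑ i, ∑ j, A i j * (sgn (ε i) * sgn (ε' j))) ≤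
      1 / (1 - ∑ i, ∑ j, A i j ^ 2) := by
  rw [Finset.expect_comm]
  have h1 : ∀ ε' : ι → Bool,
      𝔼 ε : ι → Bool, Real.exp (∑ i, ∑ j, A i j * (sgn (ε i) * sgn (ε' j))) ≤
        Real.exp (1 / 2 * ∑ i, (∑ j, A i j * sgn (ε' j)) ^ 2) := by
    intro ε'
    refine le_of_eq_of_le (Finset.expect_congr rfl fun ε _ => ?_)
      ((expect_exp_sum_mul_sgn_le (fun i => ∑ j, A i j * sgn (ε' j))).trans_eq ?_)
    · congr 1
      refine Finset.sum_congr rfl fun i _ => ?_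
      rw [Finset.sum_mul]
      exact Finset.sum_congr rfl fun j _ => by ring
    · congr 1; ring
  refine (Finset.expect_le_expect fun ε' _ => h1 ε').trans ?_
  simpa using expect_exp_mul_sum_sq_le A (μ := 1 / 2) (by norm_num) (by simpa using h)

theorem expect_expect_exp_inner_sq_le {μ : ℝ} (hμ : 0 ≤ μ) (h : 2 * μ * Fintype.card ι < 1) :
    𝔼 ε : ι → Bool, 𝔼 ε' : ι → Bool, Real.exp (μ * (∑ i, sgn (ε i) * sgn (ε' i)) ^ 2) ≤
      1 / (1 - 2 * μ * Fintype.card ι) := by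
  refine Finset.expect_le Finset.univ_nonempty fun ε _ => ?_
  simpa using expect_exp_mul_sq_le (fun i => sgn (ε i)) hμ (by simpa using h)

end Rademacher

/-! ### Le Cam's bound for the transcripts of fixed quantizers -/

section Testing

open scoped BigOperators

variable {d m : ℕ} {Y : Fin m → Type*} [∀ j, Fintype (Y j)] (q : ∀ j, Quantizer d (Y j))

/-- Le Cam's method with the chi-square divergence: the sum of the error of `T` under `P_0` and its
average error over the points `t i` is bounded below through the second moment of the likelihood
ratio of the transcripts. -/
theorem one_sub_sqrt_le_testing_error {I : Type*} [Fintype I] [Nonempty I] (t : I → Vec d)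
    (T : (∀ j, Y j) → Fin 2) {κ : ℝ}
    (hκ : 𝔼 i, 𝔼 i', ∏ j, (q j).chiKernel (t i) (t i') ≤ 1 + κ ^ 2) (hκ0 : 0 ≤ κ) :
    1 - κ ≤ ∑ y with T y = 1, ∏ j, (q j).prob (y j) +
      𝔼 i, ∑ y with T y = 0, ∏ j, (q j).probAt (t i) (y j) := by
  classical
  set P : (∀ j, Y j) → ℝ := fun y => ∏ j, (q j).prob (y j) with hP
  set L : (∀ j, Y j) → ℝ := fun y => 𝔼 i, ∏ j, (q j).probAt (t i) (y j) with hL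
  have hP0 : ∀ y, 0 ≤ P y := fun y => Finset.prod_nonneg fun j _ => (q j).prob_nonneg _
  have hsum : ∀ f : ∀ j, Y j → ℝ, ∑ y : ∀ j, Y j, ∏ j, f j (y j) = ∏ j, ∑ y, f j y := by
    intro f
    rw [Finset.prod_univ_sum, Fintype.piFinset_univ]
  have hP1 : ∑ y, P y = 1 := by
    simp only [hP]
    rw [hsum]
    simp [Quantizer.sum_prob]
  have hL1 : ∑ y, L y = 1 := by
    simp only [hL]
    rw [← Finset.expect_sum_comm]
    simp_rw [hsum fun j => (q j).probAt (t _), Quantizer.sum_probAt, Finset.prod_const_one]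
    exact Fintype.expect_const 1
  have hPL : ∀ y, P y = 0 → L y = 0 := by
    intro y hy
    obtain ⟨j, -, hj⟩ := Finset.prod_eq_zero_iff.1 hy
    simp only [hL]
    refine (Finset.expect_congr rfl fun i _ => ?_).trans (Fintype.expect_const 0)
    exact Finset.prod_eq_zero (Finset.mem_univ j) ((q j).probAt_eq_zero hj _)
  have hchi : ∑ y, L y ^ 2 / P y = 𝔼 i, 𝔼 i', ∏ j, (q j).chiKernel (t i) (t i') := by
    have h1 : ∀ i i', ∏ j, (q j).chiKernel (t i) (t i') = ∑ y : ∀ j, Y j,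
        (∏ j, (q j).probAt (t i) (y j)) * (∏ j, (q j).probAt (t i') (y j)) / P y := by
      intro i i'
      simp only [Quantizer.chiKernel, hP]
      rw [← hsum]
      simp_rw [Finset.prod_div_distrib, Finset.prod_mul_distrib]
    simp_rw [h1, Finset.expect_sum_comm]
    refine Finset.sum_congr rfl fun y _ => ?_
    simp_rw [← Finset.expect_div]
    rw [sq, Finset.expect_mul_expect]
  have hvar : ∑ y, (L y - P y) ^ 2 / P y = ∑ y, L y ^ 2 / P y - 1 := by
    have h1 : ∀ y, (L y - P y) ^ 2 / P y = L y ^ 2 / P y - 2 * L y + P y := by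
      intro y
      rcases eq_or_ne (P y) 0 with hy | hy
      · simp [hy, hPL y hy]
      · field_simp; ring
    simp_rw [h1, Finset.sum_add_distrib, Finset.sum_sub_distrib, ← Finset.mul_sum, hL1, hP1]
    ring
  -- the Cauchy–Schwarz inequality bounds the squared `L¹` distance by the chi-square divergence
  have hCS : (∑ y, |L y - P y|) ^ 2 ≤ κ ^ 2 := by
    have h1 := Finset.sum_sq_le_sum_mul_sum_of_sq_le_mul (Finset.univ : Finset (∀ j, Y j))
      (r := fun y => |L y - P y|) (f := P) (g := fun y => (L y - P y) ^ 2 / P y)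
      (fun y _ => hP0 y) (fun y _ => div_nonneg (sq_nonneg _) (hP0 y)) (fun y _ => by
        rw [sq_abs]
        rcases eq_or_ne (P y) 0 with hy | hy
        · simp [hy, hPL y hy]
        · exact le_of_eq (by field_simp))
    rw [hP1, one_mul, hvar, hchi] at h1
    linarith
  have hTV := abs_le_of_sq_le_sq' hCS hκ0 |>.2
  have hswap : 𝔼 i, ∑ y with T y = 0, ∏ j, (q j).probAt (t i) (y j) = ∑ y with T y = 0, L y := by
    rw [Finset.expect_sum_comm]
  rw [hswap]
  have hsplit : ∑ y with T y = 1, P y + ∑ y with T y = 0, P y = 1 := by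
    rw [← hP1, ← Finset.sum_filter_add_sum_filter_not Finset.univ (fun y => T y = 1) P]
    congr 2
    ext y
    simp only [Finset.mem_filter_univ]
    omega
  have habs : ∑ y with T y = 0, (P y - L y) ≤ ∑ y, |L y - P y| := by
    refine (Finset.sum_le_sum fun y _ => ?_).trans
      (Finset.sum_le_sum_of_subset_of_nonneg (Finset.filter_subset _ _) fun y _ _ => abs_nonneg _)
    rw [abs_sub_comm]
    exact le_abs_self _
  rw [Finset.sum_sub_distrib] at habs
  linarith

/-! ### The second moment under a randomly signed prior -/

/-- The prior `a ∑_i ε_i e_i`, with `ε` a sign vector and `e` an orthonormal family. -/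
def signedSum {ι : Type*} [Fintype ι] (a : ℝ) (e : ι → Vec d) (ε : ι → Bool) : Vec d :=
  a • ∑ i, sgn (ε i) • e i

variable {ι : Type*} [Fintype ι]

theorem inner_signedSum {e : ι → Vec d} (he : Orthonormal ℝ e) (a : ℝ) (ε ε' : ι → Bool) :
    inner ℝ (signedSum a e ε) (signedSum a e ε') = a ^ 2 * ∑ i, sgn (ε i) * sgn (ε' i) := by
  rw [signedSum, signedSum, real_inner_smul_left, real_inner_smul_right, he.inner_sum]
  simp only [conj_trivial]
  ring

theorem norm_signedSum {e : ι → Vec d} (he : Orthonormal ℝ e) {a : ℝ} (ha : 0 ≤ a)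
    (ε : ι → Bool) : ‖signedSum a e ε‖ = a * √(Fintype.card ι) := by
  rw [norm_eq_sqrt_real_inner, inner_signedSum he]
  simp only [← sq, sgn_sq]
  rw [Real.sqrt_mul (sq_nonneg a), Real.sqrt_sq ha]
  simp

/-- The total information operator `F = ∑_j ∑_y p_y μ_y ⊗ μ_y`, the sum over the machines of the
covariances of the conditional means. -/
def infoOp : Vec d →ₗ[ℝ] Vec d :=
  ∑ j, ∑ y, (q j).prob y •
    ((innerSL ℝ ((q j).mean y)).smulRight ((q j).mean y) : Vec d →L[ℝ] Vec d).toLinearMap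

/-- The total information form `⟪s, F t⟫`. -/
def totalInfo (s t : Vec d) : ℝ := inner ℝ s (infoOp q t)

theorem totalInfo_eq_sum (s t : Vec d) : totalInfo q s t = ∑ j, (q j).infoKernel s t := by
  simp only [totalInfo, infoOp, Quantizer.infoKernel, LinearMap.sum_apply, inner_sum,
    LinearMap.smul_apply, real_inner_smul_right]
  refine Finset.sum_congr rfl fun j _ => Finset.sum_congr rfl fun y _ => ?_
  simp [real_inner_smul_right, real_inner_comm t, mul_comm]

theorem totalInfo_comm (s t : Vec d) : totalInfo q s t = totalInfo q t s := by
  simp only [totalInfo_eq_sum, Quantizer.infoKernel, mul_comm (inner ℝ s _ : ℝ)]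

theorem totalInfo_signedSum (a : ℝ) (e : ι → Vec d) (ε ε' : ι → Bool) :
    totalInfo q (signedSum a e ε) (signedSum a e ε') =
      a ^ 2 * ∑ i, ∑ i', totalInfo q (e i) (e i') * (sgn (ε i) * sgn (ε' i')) := by
  simp only [totalInfo, signedSum, map_smul, map_sum, real_inner_smul_left, real_inner_smul_right,
    sum_inner, inner_sum, Finset.mul_sum]
  rw [Finset.sum_comm]
  exact Finset.sum_congr rfl fun i _ => Finset.sum_congr rfl fun j _ => by ring

/-- If the information is spread out over the span of `e`, then the second moment of the
likelihood ratio under the randomly signed prior is close to one. -/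
theorem expect_expect_prod_chiKernel_le [DecidableEq ι] {e : ι → Vec d} (he : Orthonormal ℝ e) (a : ℝ) {δ : ℝ}
    (hδ : δ < 1)
    (hinfo : 16 * a ^ 4 * ∑ i, ∑ i', totalInfo q (e i) (e i') ^ 2 ≤ δ)
    (hdim : 8 * m * a ^ 4 * Fintype.card ι ≤ δ) :
    𝔼 ε : ι → Bool, 𝔼 ε' : ι → Bool,
      ∏ j, (q j).chiKernel (signedSum a e ε) (signedSum a e ε') ≤ 1 / (1 - δ) := by
  have hpos : 0 < 1 - δ := by linarith
  have hbil := expect_expect_exp_bilin_le (fun i i' : ι => 4 * a ^ 2 * totalInfo q (e i) (e i'))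
  have hsq := expect_expect_exp_inner_sq_le (ι := ι) (μ := 4 * m * a ^ 4) (by positivity)
  have e1 : ∑ i, ∑ i', (4 * a ^ 2 * totalInfo q (e i) (e i')) ^ 2 =
      16 * a ^ 4 * ∑ i, ∑ i', totalInfo q (e i) (e i') ^ 2 := by
    simp_rw [Finset.mul_sum]
    exact Finset.sum_congr rfl fun i _ => Finset.sum_congr rfl fun j _ => by ring
  have e2 : 2 * (4 * m * a ^ 4) * (Fintype.card ι : ℝ) = 8 * m * a ^ 4 * Fintype.card ι := by ring
  rw [e1] at hbil
  rw [e2] at hsq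
  have hbil2 := (hbil (by linarith)).trans (one_div_le_one_div_of_le hpos (by linarith))
  have hsq2 := (hsq (by linarith)).trans (one_div_le_one_div_of_le hpos (by linarith))
  -- the two exponentials are separated by the Cauchy–Schwarz inequality, which doubles the exponents
  set f : (ι → Bool) × (ι → Bool) → ℝ := fun p =>
    Real.exp (2 * totalInfo q (signedSum a e p.1) (signedSum a e p.2)) with hf
  set g : (ι → Bool) × (ι → Bool) → ℝ := fun p =>
    Real.exp (2 * m * inner ℝ (signedSum a e p.1) (signedSum a e p.2) ^ 2) with hg
  have hf2 : 𝔼 p, f p ^ 2 ≤ 1 / (1 - δ) := by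
    refine le_trans (le_of_eq ?_) hbil2
    rw [← Finset.univ_product_univ, Finset.expect_product]
    refine Finset.expect_congr rfl fun ε _ => Finset.expect_congr rfl fun ε' _ => ?_
    simp only [hf]
    rw [totalInfo_signedSum, ← Real.exp_nat_mul]
    simp_rw [mul_assoc, ← Finset.mul_sum]
    congr 1
    push_cast; ring
  have hg2 : 𝔼 p, g p ^ 2 ≤ 1 / (1 - δ) := by
    refine le_trans (le_of_eq ?_) hsq2
    rw [← Finset.univ_product_univ, Finset.expect_product]
    refine Finset.expect_congr rfl fun ε _ => Finset.expect_congr rfl fun ε' _ => ?_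
    simp only [hg]
    rw [inner_signedSum he, ← Real.exp_nat_mul]
    congr 1
    push_cast; ring
  have hCS : (𝔼 p, f p * g p) ^ 2 ≤ (1 / (1 - δ)) ^ 2 := by
    refine (Finset.expect_mul_sq_le_sq_mul_sq _ _ _).trans ?_
    rw [sq (1 / (1 - δ))]
    exact mul_le_mul hf2 hg2 (Finset.expect_nonneg fun _ _ => sq_nonneg _) (by positivity)
  refine le_trans ?_ (abs_le_of_sq_le_sq' hCS (by positivity)).2
  rw [← Finset.univ_product_univ, Finset.expect_product]
  simp_rw [Fintype.expect_eq_sum_div_card, ← Finset.sum_div]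
  simp only [hf, hg, totalInfo_eq_sum]
  exact div_le_div_of_nonneg_right (div_le_div_of_nonneg_right
    (sum_sum_prod_chiKernel_le q _) (by positivity)) (by positivity)

/-- The testing bound for a randomly signed prior along an orthonormal family `e`. -/
theorem testing_error_ge [DecidableEq ι] {e : ι → Vec d} (he : Orthonormal ℝ e) (a : ℝ) {α : ℝ}
    (hα : α ∈ Set.Ioo (0 : ℝ) 1)
    (hinfo : 16 * a ^ 4 * ∑ i, ∑ i', totalInfo q (e i) (e i') ^ 2 ≤ (1 - α) ^ 2 / 8)
    (hdim : 8 * m * a ^ 4 * Fintype.card ι ≤ (1 - α) ^ 2 / 8) (T : (∀ j, Y j) → Fin 2) :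
    (1 + α) / 2 ≤ ∑ y with T y = 1, ∏ j, (q j).prob (y j) +
      𝔼 ε : ι → Bool, ∑ y with T y = 0, ∏ j, (q j).probAt (signedSum a e ε) (y j) := by
  obtain ⟨h0, h1⟩ := hα
  have hδ : (1 - α) ^ 2 / 8 < 1 := by nlinarith
  have h2 := expect_expect_prod_chiKernel_le q he a hδ hinfo hdim
  have h3 : 1 / (1 - (1 - α) ^ 2 / 8) ≤ 1 + ((1 - α) / 2) ^ 2 := by
    rw [div_le_iff₀ (by linarith)]
    have h4 : (1 - α) ^ 2 ≤ 1 := by nlinarith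
    nlinarith [sq_nonneg (1 - α)]
  have h4 := one_sub_sqrt_le_testing_error q _ T (h2.trans h3) (by linarith)
  linarith

/-! ### Bounds for the total information -/

/-- The trace of the total information operator. -/
def totalEnergy : ℝ := ∑ j, (q j).energy

theorem totalEnergy_nonneg : 0 ≤ totalEnergy q := Finset.sum_nonneg fun j _ => (q j).energy_nonneg

/-- The communication constraint: each machine contributes at most `2 log (2 ^ b) ≤ 2 b`, and at most
`d`. -/
theorem totalEnergy_le {b : ℕ} (hY : ∀ j, Fintype.card (Y j) ≤ 2 ^ b) :
    totalEnergy q ≤ 2 * m * min (b : ℝ) d := by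
  have h : ∀ j, (q j).energy ≤ 2 * min (b : ℝ) d := by
    intro j
    have h1 := (q j).energy_le_dim
    have h2 := (q j).energy_le_log_card
    have hpos : (0 : ℝ) < Fintype.card (Y j) := by
      rw [Nat.cast_pos, Fintype.card_pos_iff]
      by_contra h
      rw [not_nonempty_iff] at h
      simpa using (q j).sum_eq_one 0
    have h3 : Real.log (Fintype.card (Y j)) ≤ b := by
      have h4 : Real.log (Fintype.card (Y j)) ≤ Real.log ((2 : ℝ) ^ b) :=
        Real.log_le_log hpos (by exact_mod_cast hY j)
      rw [Real.log_pow] at h4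
      have h5 := Real.log_two_lt_d9
      have h6 : (0 : ℝ) ≤ b := Nat.cast_nonneg b
      nlinarith
    have h7 : (0 : ℝ) ≤ d := Nat.cast_nonneg d
    rw [mul_min_of_nonneg _ _ zero_le_two]
    exact le_min (by linarith) (by linarith)
  refine (Finset.sum_le_sum fun j _ => h j).trans_eq ?_
  simp; ring

theorem Quantizer.infoKernel_self_nonneg {Y : Type*} [Fintype Y] (q : Quantizer d Y) (t : Vec d) :
    0 ≤ q.infoKernel t t :=
  Finset.sum_nonneg fun y _ => mul_nonneg (q.prob_nonneg y) (mul_self_nonneg _)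

theorem totalInfo_self_nonneg (t : Vec d) : 0 ≤ totalInfo q t t := by
  rw [totalInfo_eq_sum]
  exact Finset.sum_nonneg fun j _ => (q j).infoKernel_self_nonneg t

theorem totalInfo_self_le (t : Vec d) : totalInfo q t t ≤ m * ‖t‖ ^ 2 := by
  have h : ∀ j, (q j).infoKernel t t ≤ ‖t‖ ^ 2 := fun j => by
    simpa only [Quantizer.infoKernel, ← sq] using (q j).sum_prob_mul_inner_mean_sq_le t
  rw [totalInfo_eq_sum]
  refine (Finset.sum_le_sum fun j _ => h j).trans_eq ?_
  simp

theorem sum_totalInfo_self (e : OrthonormalBasis ι ℝ (Vec d)) :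
    ∑ i, totalInfo q (e i) (e i) = totalEnergy q := by
  simp only [totalInfo_eq_sum, totalEnergy, Quantizer.infoKernel, Quantizer.energy,
    ← e.sum_sq_inner_right, Finset.mul_sum, ← sq]
  rw [Finset.sum_comm]
  exact Finset.sum_congr rfl fun j _ => Finset.sum_comm

/-- Since `0 ≤ F ≤ m`, one has `F² ≤ m F`. -/
theorem norm_infoOp_sq_le (hm : 0 < m) (v : Vec d) : ‖infoOp q v‖ ^ 2 ≤ m * totalInfo q v v := by
  -- the inequality is `0 ≤ ⟪w, F w⟫` at `w = m v - F v`
  have h1 := totalInfo_self_nonneg q ((m : ℝ) • v - infoOp q v)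
  have h2 := totalInfo_self_le q (infoOp q v)
  have h3 : totalInfo q ((m : ℝ) • v - infoOp q v) ((m : ℝ) • v - infoOp q v) =
      m ^ 2 * totalInfo q v v - 2 * m * ‖infoOp q v‖ ^ 2 +
        totalInfo q (infoOp q v) (infoOp q v) := by
    have h4 : totalInfo q v (infoOp q v) = ‖infoOp q v‖ ^ 2 := by
      rw [totalInfo_comm, totalInfo, real_inner_self_eq_norm_sq]
    have h5 : totalInfo q (infoOp q v) v = ‖infoOp q v‖ ^ 2 := by
      rw [totalInfo, real_inner_self_eq_norm_sq]
    simp only [totalInfo, map_sub, map_smul, inner_sub_left, inner_sub_right, real_inner_smul_left,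
      real_inner_smul_right] at h4 h5 ⊢
    rw [h4, h5]; ring
  have hm' : (0 : ℝ) < m := Nat.cast_pos.2 hm
  rw [h3] at h1
  have h6 : (m : ℝ) * ‖infoOp q v‖ ^ 2 ≤ m * (m * totalInfo q v v) := by nlinarith
  exact le_of_mul_le_mul_left h6 hm'

theorem sum_sum_totalInfo_sq_le (hm : 0 < m) (e : OrthonormalBasis ι ℝ (Vec d)) :
    ∑ i, ∑ i', totalInfo q (e i) (e i') ^ 2 ≤ m * totalEnergy q := by
  rw [Finset.sum_comm, ← sum_totalInfo_self q e, Finset.mul_sum]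
  refine Finset.sum_le_sum fun i _ => ?_
  rw [show ∑ i', totalInfo q (e i') (e i) ^ 2 = ‖infoOp q (e i)‖ ^ 2 from e.sum_sq_inner_right _]
  exact norm_infoOp_sq_le q hm _

/-- At least half of the eigenvalues of the total information operator are at most twice their
average. -/
theorem exists_orthonormal_totalInfo_small (hd : 0 < d) :
    ∃ (S : Finset (Fin d)) (e : S → Vec d), Orthonormal ℝ e ∧ (d : ℝ) ≤ 2 * Fintype.card S ∧
      ∑ i, ∑ i', totalInfo q (e i) (e i') ^ 2 ≤
        Fintype.card S * (2 * totalEnergy q / d) ^ 2 := by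
  have hsymm : (infoOp q).IsSymmetric := fun s t => by
    rw [real_inner_comm]
    exact totalInfo_comm q t s
  have hfin : Module.finrank ℝ (Vec d) = d := by simp
  set e := hsymm.eigenvectorBasis hfin with he
  have hoff : ∀ i i', i ≠ i' → totalInfo q (e i) (e i') = 0 := by
    intro i i' hi
    rw [totalInfo, he, hsymm.apply_eigenvectorBasis, real_inner_smul_right, ← he,
      e.orthonormal.2 hi, mul_zero]
  have hd' : (0 : ℝ) < d := Nat.cast_pos.2 hd
  have htr := sum_totalInfo_self q e
  have hE := totalEnergy_nonneg q
  set S : Finset (Fin d) := {i | totalInfo q (e i) (e i) ≤ 2 * totalEnergy q / d} with hS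
  refine ⟨S, fun i => e i, e.orthonormal.comp _ Subtype.val_injective, ?_, ?_⟩
  · -- Markov's inequality for the eigenvalues outside `S`
    rcases hE.eq_or_lt with h0 | h0
    · have h1 : S = Finset.univ := by
        rw [hS, Finset.filter_true_of_mem]
        intro i hi
        rw [← h0] at htr ⊢
        rw [(Finset.sum_eq_zero_iff_of_nonneg fun i _ => totalInfo_self_nonneg q _).1 htr i hi]
        simp
      rw [h1]; simp; linarith
    · have h1 : (Sᶜ.card : ℝ) * (2 * totalEnergy q / d) ≤ totalEnergy q := by
        rw [← nsmul_eq_mul]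
        refine (Finset.card_nsmul_le_sum _ (fun i => totalInfo q (e i) (e i)) _ fun i hi => ?_).trans
          (le_of_le_of_eq (Finset.sum_le_sum_of_subset_of_nonneg (Finset.subset_univ _)
            fun i _ _ => totalInfo_self_nonneg q _) htr)
        simp only [hS, Finset.mem_compl, Finset.mem_filter_univ, not_le] at hi
        exact hi.le
      rw [Finset.card_compl, Fintype.card_fin, Nat.cast_sub (by simpa using S.card_le_univ)] at h1
      have h2 : ((d : ℝ) - S.card) * 2 ≤ d := by
        rw [mul_div_assoc', div_le_iff₀ hd'] at h1
        nlinarith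
      simp only [Fintype.card_coe]
      linarith
  · have h1 : ∀ i : S, ∑ i' : S, totalInfo q (e i) (e i') ^ 2 = totalInfo q (e i) (e i) ^ 2 := by
      intro i
      refine Finset.sum_eq_single i (fun i' _ hi => ?_) (by simp)
      rw [hoff i i' fun h => hi (Subtype.ext h.symm)]
      simp
    simp_rw [h1]
    refine (Finset.sum_le_card_nsmul _ _ ((2 * totalEnergy q / d) ^ 2) fun i _ => ?_).trans_eq ?_
    · have h2 := i.2
      simp only [hS, Finset.mem_filter_univ] at h2
      exact pow_le_pow_left₀ (totalInfo_self_nonneg q _) h2 2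
    · rw [nsmul_eq_mul, Finset.card_univ]

end Testing

/-! ### From protocols to quantizers -/

section Protocols

open scoped BigOperators

variable {d : ℕ}

/-- The quantizer obtained by applying a Markov kernel to an observation with noise level `σ`,
after rescaling the noise to level `1`. -/
def quantizerOf {Y : Type*} [Fintype Y] [MeasurableSpace Y] [DiscreteMeasurableSpace Y] (σ : ℝ)
    (K : Kernel (Vec d) Y) [IsMarkovKernel K] : Quantizer d Y where
  w y z := (K (σ • z)).real {y}
  measurable_w y :=
    ((K.measurable_coe (MeasurableSet.singleton y)).comp (by fun_prop)).ennreal_toReal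
  nonneg _ _ := measureReal_nonneg
  sum_eq_one z := by simp

/-- Rescaling the noise turns the law of a transcript of one machine, for the signal `σ t`, into that
of the symbol of a quantizer observing `N(t, I)`. -/
theorem lintegral_kernel_localLaw {Y : Type*} [Fintype Y] [MeasurableSpace Y]
    [DiscreteMeasurableSpace Y] (n m : ℕ) (K : Kernel (Vec d) Y) [IsMarkovKernel K]
    (t : Vec d) (y : Y) :
    ∫⁻ x, K x {y} ∂localLaw n m (√((m : ℝ) / n) • t) =
      ENNReal.ofReal ((quantizerOf √((m : ℝ) / n) K).probAt t y) := by
  set σ := √((m : ℝ) / n)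
  have hK : Measurable fun x => K x {y} := K.measurable_coe (MeasurableSet.singleton y)
  have hw := (quantizerOf σ K).measurable_w y
  rw [localLaw, lintegral_map hK (by fun_prop), Quantizer.probAt,
    ← integral_comp_const_add_stdGaussian t hw,
    ofReal_integral_eq_lintegral_ofReal _ (.of_forall fun z => (quantizerOf σ K).nonneg y _)]
  · refine lintegral_congr fun z => ?_
    simp [quantizerOf, smul_add, σ]
  · refine Integrable.of_bound (C := 1) (hw.comp (by fun_prop)).aestronglyMeasurable
      (.of_forall fun z => ?_)
    rw [Real.norm_of_nonneg ((quantizerOf σ K).nonneg y _)]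
    exact (quantizerOf σ K).w_le_one y _

variable {m : ℕ} {Y : Fin m → Type*} [∀ j, Fintype (Y j)] [∀ j, MeasurableSpace (Y j)]
  [∀ j, DiscreteMeasurableSpace (Y j)]

theorem lintegral_pi_kernel_dataLaw (n : ℕ) (K : ∀ j, Kernel (Vec d) (Y j))
    [∀ j, IsMarkovKernel (K j)] (T : (∀ j, Y j) → Fin 2) (r : Fin 2) (t : Vec d) :
    ∫⁻ x, Measure.pi (fun j => K j (x j)) {y | T y = r} ∂dataLaw n m (√((m : ℝ) / n) • t) =
      ENNReal.ofReal (∑ y with T y = r,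
        ∏ j, (quantizerOf √((m : ℝ) / n) (K j)).probAt t (y j)) := by
  classical
  have hset : {y | T y = r} = ((Finset.univ.filter fun y => T y = r : Finset (∀ j, Y j)) :
      Set (∀ j, Y j)) := by
    ext y; simp
  have h1 : ∀ x : Fin m → Vec d, Measure.pi (fun j => K j (x j)) {y | T y = r} =
      ∑ y with T y = r, ∏ j, K j (x j) {y j} := by
    intro x
    rw [hset, ← sum_measure_singleton]
    simp_rw [Measure.pi_singleton]
  have hK : ∀ (y : ∀ j, Y j) j, Measurable fun x => K j x {y j} := fun y j =>
    (K j).measurable_coe (MeasurableSet.singleton _)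
  have hprod : ∀ y : ∀ j, Y j, Measurable fun x : Fin m → Vec d => ∏ j, K j (x j) {y j} :=
    fun y => Finset.measurable_fun_prod _ fun j _ => (hK y j).comp (measurable_pi_apply j)
  simp_rw [h1]
  rw [lintegral_finsetSum _ fun y _ => hprod y,
    ENNReal.ofReal_sum_of_nonneg fun y _ => Finset.prod_nonneg fun j _ =>
      Quantizer.probAt_nonneg _ _ _]
  refine Finset.sum_congr rfl fun y _ => ?_
  rw [dataLaw, lintegral_pi_prod _ (hK y),
    ENNReal.ofReal_prod_of_nonneg fun j _ => Quantizer.probAt_nonneg _ _ _]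
  exact Finset.prod_congr rfl fun j _ => lintegral_kernel_localLaw n m (K j) t (y j)

/-- The testing bound for fixed kernels, in terms of the laws of the transcripts. -/
theorem ofReal_le_lintegral_error (n : ℕ) (K : ∀ j, Kernel (Vec d) (Y j))
    [∀ j, IsMarkovKernel (K j)] (T : (∀ j, Y j) → Fin 2) {ι : Type*} [Fintype ι] [DecidableEq ι]
    {e : ι → Vec d} (he : Orthonormal ℝ e) (a : ℝ) {α : ℝ} (hα : α ∈ Set.Ioo (0 : ℝ) 1)
    (hinfo : 16 * a ^ 4 * ∑ i, ∑ i',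
      totalInfo (fun j => quantizerOf √((m : ℝ) / n) (K j)) (e i) (e i') ^ 2 ≤ (1 - α) ^ 2 / 8)
    (hdim : 8 * m * a ^ 4 * Fintype.card ι ≤ (1 - α) ^ 2 / 8) :
    ENNReal.ofReal ((1 + α) / 2) ≤
      ∫⁻ x, Measure.pi (fun j => K j (x j)) {y | T y = 1} ∂dataLaw n m 0 +
      ∑ ε : ι → Bool, (Fintype.card (ι → Bool) : ENNReal)⁻¹ *
        ∫⁻ x, Measure.pi (fun j => K j (x j)) {y | T y = 0}
          ∂dataLaw n m (√((m : ℝ) / n) • signedSum a e ε) := by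
  have h := testing_error_ge (fun j => quantizerOf √((m : ℝ) / n) (K j)) he a hα hinfo hdim T
  have h0 := lintegral_pi_kernel_dataLaw n K T 1 0
  rw [smul_zero] at h0
  rw [h0]
  simp_rw [lintegral_pi_kernel_dataLaw]
  have hnn : ∀ (t : Vec d) (r : Fin 2), 0 ≤ ∑ y with T y = r,
      ∏ j, (quantizerOf √((m : ℝ) / n) (K j)).probAt t (y j) := fun t r =>
    Finset.sum_nonneg fun y _ => Finset.prod_nonneg fun j _ => Quantizer.probAt_nonneg _ _ _
  have hprob : ∀ j y, (quantizerOf √((m : ℝ) / n) (K j)).probAt 0 y =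
      (quantizerOf √((m : ℝ) / n) (K j)).prob y := fun j y => by
    simp [Quantizer.probAt, Quantizer.prob]
  have hcard : (Fintype.card (ι → Bool) : ENNReal)⁻¹ =
      ENNReal.ofReal ((Fintype.card (ι → Bool) : ℝ)⁻¹) := by
    rw [ENNReal.ofReal_inv_of_pos (by exact_mod_cast Fintype.card_pos), ENNReal.ofReal_natCast]
  rw [hcard]
  simp_rw [← ENNReal.ofReal_mul (inv_nonneg.2 (Nat.cast_nonneg (α := ℝ) (Fintype.card (ι → Bool))))]
  rw [← ENNReal.ofReal_sum_of_nonneg fun ε _ => mul_nonneg (by positivity) (hnn _ _),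
    ← ENNReal.ofReal_add (hnn _ _) (Finset.sum_nonneg fun ε _ =>
      mul_nonneg (by positivity) (hnn _ _))]
  refine ENNReal.ofReal_le_ofReal (h.trans_eq ?_)
  simp_rw [hprob]
  rw [Fintype.expect_eq_sum_div_card, Finset.sum_div]
  simp_rw [div_eq_inv_mul]

/-- An average over points of a set is at most the supremum over that set. -/
theorem sum_inv_card_mul_le_iSup {I A : Type*} [Fintype I] [Nonempty I] {s : Set A} {f : I → A}
    (hf : ∀ i, f i ∈ s) (g : A → ENNReal) :
    ∑ i, (Fintype.card I : ENNReal)⁻¹ * g (f i) ≤ ⨆ a ∈ s, g a := by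
  refine (Finset.sum_le_sum fun i _ => mul_le_mul_right (le_iSup₂ (f := fun a _ => g a)
    (f i) (hf i)) _).trans_eq ?_
  rw [Finset.sum_const, Finset.card_univ, nsmul_eq_mul, ← mul_assoc,
    ENNReal.mul_inv_cancel (by simp) (by simp), one_mul]

/-- The amplitude at which the randomly signed prior has norm `|ρ|`. -/
def amplitude (n m k : ℕ) (ρ : ℝ) : ℝ := |ρ| / (√((m : ℝ) / n) * √k)

theorem smul_signedSum_mem_alternative {n m : ℕ} (hn : 0 < n) (hm : 0 < m) (ρ : ℝ) {ι : Type*}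
    [Fintype ι] [Nonempty ι] {e : ι → Vec d} (he : Orthonormal ℝ e) (ε : ι → Bool) :
    √((m : ℝ) / n) • signedSum (amplitude n m (Fintype.card ι) ρ) e ε ∈ alternative d ρ := by
  have h1 : 0 < √((m : ℝ) / n) := Real.sqrt_pos.2 (by positivity)
  have h2 : 0 < √(Fintype.card ι : ℝ) := Real.sqrt_pos.2 (by exact_mod_cast Fintype.card_pos)
  have h3 : ‖√((m : ℝ) / n) • signedSum (amplitude n m (Fintype.card ι) ρ) e ε‖ = |ρ| := by
    rw [norm_smul, Real.norm_of_nonneg h1.le, norm_signedSum he (by unfold amplitude; positivity),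
      amplitude]
    field_simp
  simp only [alternative, Set.mem_ofPred_eq, h3]
  exact le_abs_self ρ

theorem amplitude_pow_four {n m k : ℕ} (ρ : ℝ) :
    amplitude n m k ρ ^ 4 = (ρ ^ 2 * n) ^ 2 / (m ^ 2 * k ^ 2) := by
  have h1 : √((m : ℝ) / n) ^ 4 = ((m : ℝ) / n) ^ 2 := by
    rw [show (4 : ℕ) = 2 * 2 from rfl, pow_mul, Real.sq_sqrt (by positivity)]
  have h2 : √(k : ℝ) ^ 4 = (k : ℝ) ^ 2 := by
    rw [show (4 : ℕ) = 2 * 2 from rfl, pow_mul, Real.sq_sqrt (by positivity)]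
  rw [amplitude, div_pow, mul_pow, h1, h2, show |ρ| ^ 4 = (|ρ| ^ 2) ^ 2 by ring, sq_abs, div_pow]
  field_simp

/-- The hypothesis on `ρ`, squared and freed of the minimum. -/
theorem sq_le_of_lt_mul_min {n m d : ℕ} {ρ c x : ℝ} (hn : 0 < n) (hc : 0 < c)
    (h : ρ ^ 2 < c * (√(d : ℝ) / (n : ℝ)) * min x √(m : ℝ)) :
    (ρ ^ 2 * n) ^ 2 ≤ c ^ 2 * d * x ^ 2 ∧ (ρ ^ 2 * n) ^ 2 ≤ c ^ 2 * d * m := by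
  have hn' : (0 : ℝ) < n := Nat.cast_pos.2 hn
  have h1 : ρ ^ 2 * n ≤ c * √d * min x √(m : ℝ) := by
    have h2 : c * (√(d : ℝ) / (n : ℝ)) * min x √(m : ℝ) = c * √d * min x √(m : ℝ) / n := by
      ring
    rw [h2, lt_div_iff₀ hn'] at h
    exact h.le
  have h3 : ∀ y, min x √(m : ℝ) ≤ y → (ρ ^ 2 * n) ^ 2 ≤ c ^ 2 * d * y ^ 2 := by
    intro y hy
    have h4 : ρ ^ 2 * n ≤ c * √d * y := h1.trans (by gcongr)
    refine (pow_le_pow_left₀ (by positivity) h4 2).trans_eq ?_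
    rw [mul_pow, mul_pow, Real.sq_sqrt (Nat.cast_nonneg d)]
  refine ⟨h3 x (min_le_left _ _), ?_⟩
  simpa using h3 √(m : ℝ) (min_le_right _ _)

theorem amplitude_dim_bound {n m k : ℕ} {ρ α : ℝ} (hm : 0 < m) (hk : 0 < k) (hdk : (d : ℝ) ≤ 2 * k)
    (h : (ρ ^ 2 * n) ^ 2 ≤ ((1 - α) / 64) ^ 2 * d * m) :
    8 * m * amplitude n m k ρ ^ 4 * k ≤ (1 - α) ^ 2 / 8 := by
  have hm' : (0 : ℝ) < m := Nat.cast_pos.2 hm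
  have hk' : (0 : ℝ) < k := Nat.cast_pos.2 hk
  rw [amplitude_pow_four]
  have h1 : 8 * (m : ℝ) * ((ρ ^ 2 * n) ^ 2 / (m ^ 2 * k ^ 2)) * k =
      8 * (ρ ^ 2 * n) ^ 2 / (m * k) := by field_simp
  rw [h1, div_le_iff₀ (by positivity)]
  have h2 : ((1 - α) / 64) ^ 2 * d * m ≤ ((1 - α) / 64) ^ 2 * (2 * k) * m := by gcongr
  have h3 : 0 ≤ (1 - α) ^ 2 * k * m := by positivity
  nlinarith

/-- With private coins the kernels are known when the prior is chosen, so that it can be put on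
eigenvectors of the total information operator with small eigenvalues. -/
theorem PrivateCoinProtocol.risk_ge {m b n : ℕ} (hn : 0 < n) (hm : 0 < m) (hd : 0 < d)
    (hb : 0 < b) {α : ℝ} (hα : α ∈ Set.Ioo (0 : ℝ) 1) {ρ : ℝ}
    (hρ : ρ ^ 2 < (1 - α) / 64 * (√(d : ℝ) / (n : ℝ)) *
      min ((d : ℝ) / min (b : ℝ) (d : ℝ)) √(m : ℝ))
    (P : PrivateCoinProtocol.{v} m d b) : ENNReal.ofReal ((1 + α) / 2) ≤ P.risk n ρ := by
  let _ : ∀ j, Fintype (P.Y j) := fun j => Fintype.ofFinite _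
  have hd' : (0 : ℝ) < d := Nat.cast_pos.2 hd
  have hm' : (0 : ℝ) < m := Nat.cast_pos.2 hm
  have hM : 0 < min (b : ℝ) (d : ℝ) := lt_min (Nat.cast_pos.2 hb) hd'
  obtain ⟨hρ1, hρ2⟩ := sq_le_of_lt_mul_min hn (by linarith [hα.2]) hρ
  set q := fun j => quantizerOf √((m : ℝ) / n) (P.K j)
  obtain ⟨S, e, he, hS, hinfo⟩ := exists_orthonormal_totalInfo_small q hd
  have hS0 : 0 < Fintype.card S := by
    by_contra h0
    rw [not_lt, nonpos_iff_eq_zero] at h0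
    rw [h0] at hS
    simp at hS; omega
  have hSne : Nonempty S := Fintype.card_pos_iff.1 hS0
  have hS' : (0 : ℝ) < Fintype.card S := Nat.cast_pos.2 hS0
  have hE := totalEnergy_le q (b := b) fun j => by
    simpa [Nat.card_eq_fintype_card] using P.card_Y j
  have hbound : 16 * amplitude n m (Fintype.card S) ρ ^ 4 *
      ∑ i, ∑ i', totalInfo q (e i) (e i') ^ 2 ≤ (1 - α) ^ 2 / 8 := by
    set M := min (b : ℝ) (d : ℝ)
    have h1 : ∑ i, ∑ i', totalInfo q (e i) (e i') ^ 2 ≤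
        Fintype.card S * (2 * (2 * m * M) / d) ^ 2 := by
      refine hinfo.trans ?_
      have := totalEnergy_nonneg q
      gcongr
    rw [amplitude_pow_four]
    calc _ ≤ 16 * (((1 - α) / 64) ^ 2 * d * (d / M) ^ 2 / (m ^ 2 * (Fintype.card S : ℝ) ^ 2)) *
          (Fintype.card S * (2 * (2 * m * M) / d) ^ 2) := by gcongr
      _ = (1 - α) ^ 2 / 16 * (d / Fintype.card S) := by field_simp; ring
      _ ≤ (1 - α) ^ 2 / 16 * 2 := by
          gcongr
          rwa [div_le_iff₀ hS']
      _ = _ := by ring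
  have h := ofReal_le_lintegral_error n P.K P.T he _ hα hbound
    (amplitude_dim_bound hm hS0 hS hρ2)
  have hlaw : ∀ (r : Fin 2) f, P.jointLaw n f {ω | P.T ω.2 = r} =
      ∫⁻ x, Measure.pi (fun j => P.K j (x j)) {y | P.T y = r} ∂dataLaw n m f := by
    intro r f
    have hms : MeasurableSet {ω : (Fin m → Vec d) × (∀ j, P.Y j) | P.T ω.2 = r} :=
      measurable_snd (Set.toFinite {y | P.T y = r}).measurableSet
    rw [jointLaw, Measure.compProd_apply hms]
    rfl
  rw [risk]
  refine h.trans (add_le_add (hlaw 1 0).ge ?_)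
  refine le_trans (le_of_eq ?_) (sum_inv_card_mul_le_iSup
    (fun ε => smul_signedSum_mem_alternative hn hm ρ he ε) _)
  simp_rw [hlaw]

/-- With a public coin the prior may not depend on the coin; signs along the coordinate axes are used
for every value of the coin, and the bounds are averaged over the coin. -/
theorem PublicCoinProtocol.risk_ge {m b n : ℕ} (hn : 0 < n) (hm : 0 < m) (hd : 0 < d)
    (hb : 0 < b) {α : ℝ} (hα : α ∈ Set.Ioo (0 : ℝ) 1) {ρ : ℝ}
    (hρ : ρ ^ 2 < (1 - α) / 64 * (√(d : ℝ) / (n : ℝ)) *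
      min √((d : ℝ) / min (b : ℝ) (d : ℝ)) √(m : ℝ))
    (P : PublicCoinProtocol.{u, v} m d b) : ENNReal.ofReal ((1 + α) / 2) ≤ P.risk n ρ := by
  let _ : ∀ j, Fintype (P.Y j) := fun j => Fintype.ofFinite _
  have hd' : (0 : ℝ) < d := Nat.cast_pos.2 hd
  have hm' : (0 : ℝ) < m := Nat.cast_pos.2 hm
  have hM : 0 < min (b : ℝ) (d : ℝ) := lt_min (Nat.cast_pos.2 hb) hd'
  obtain ⟨hρ1, hρ2⟩ := sq_le_of_lt_mul_min hn (by linarith [hα.2]) hρ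
  rw [Real.sq_sqrt (by positivity)] at hρ1
  have hne : Nonempty (Fin d) := ⟨⟨0, hd⟩⟩
  set e := EuclideanSpace.basisFun (Fin d) ℝ
  let K : P.U → ∀ j, Kernel (Vec d) (P.Y j) := fun u j =>
    (P.K j).comap (fun x => (x, u)) (by fun_prop)
  have hK : ∀ u j, IsMarkovKernel (K u j) := fun u j => by
    simp only [K]; infer_instance
  set A : Fin 2 → Vec d → P.U → ENNReal := fun r f u =>
    ∫⁻ x, Measure.pi (fun j => K u j (x j)) {y | P.T y = r} ∂dataLaw n m f with hA
  have hmeasT : ∀ r, MeasurableSet {y | P.T y = r} := fun r => (Set.toFinite _).measurableSet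
  have hkernel : ∀ (r : Fin 2) (x : Fin m → Vec d) (u : P.U),
      Measure.pi (fun j => K u j (x j)) {y | P.T y = r} =
        P.transcriptKernel (x, u) {y | P.T y = r} := fun _ _ _ => rfl
  have hmeas : ∀ r, Measurable fun p => P.transcriptKernel p {y | P.T y = r} := fun r =>
    P.transcriptKernel.measurable_coe (hmeasT r)
  have hAmeas : ∀ r f, Measurable (A r f) := fun r f => by
    simp only [hA, hkernel]
    exact (hmeas r).lintegral_prod_left'
  have hlaw : ∀ (r : Fin 2) f, P.jointLaw n f {ω | P.T ω.2 = r} = ∫⁻ u, A r f u ∂P.PU := by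
    intro r f
    have hms : MeasurableSet {ω : ((Fin m → Vec d) × P.U) × (∀ j, P.Y j) | P.T ω.2 = r} :=
      measurable_snd (hmeasT r)
    rw [jointLaw, Measure.compProd_apply hms]
    exact lintegral_prod_symm _ (hmeas r).aemeasurable
  have hu : ∀ u, ENNReal.ofReal ((1 + α) / 2) ≤ A 1 0 u +
      ∑ ε : Fin d → Bool, (Fintype.card (Fin d → Bool) : ENNReal)⁻¹ *
        A 0 (√((m : ℝ) / n) • signedSum (amplitude n m (Fintype.card (Fin d)) ρ) e ε) u := by
    intro u
    set q := fun j => quantizerOf √((m : ℝ) / n) (K u j)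
    have hE := totalEnergy_le q (b := b) fun j => by
      simpa [Nat.card_eq_fintype_card] using P.card_Y j
    have hinfo := sum_sum_totalInfo_sq_le q hm e
    refine ofReal_le_lintegral_error n (K u) P.T e.orthonormal _ hα ?_
      (amplitude_dim_bound hm (by simpa using hd) ?_ hρ2)
    · set M := min (b : ℝ) (d : ℝ)
      have h1 : ∑ i, ∑ i', totalInfo q (e i) (e i') ^ 2 ≤ m * (2 * m * M) :=
        hinfo.trans (by gcongr)
      rw [amplitude_pow_four, Fintype.card_fin]
      calc _ ≤ 16 * (((1 - α) / 64) ^ 2 * d * (d / M) / (m ^ 2 * (d : ℝ) ^ 2)) *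
            (m * (2 * m * M)) := by gcongr
        _ = (1 - α) ^ 2 / 128 := by field_simp; ring
        _ ≤ _ := by nlinarith [sq_nonneg (1 - α)]
    · simp; linarith
  calc ENNReal.ofReal ((1 + α) / 2) = ∫⁻ _, ENNReal.ofReal ((1 + α) / 2) ∂P.PU := by simp
    _ ≤ ∫⁻ u, (A 1 0 u + ∑ ε : Fin d → Bool, (Fintype.card (Fin d → Bool) : ENNReal)⁻¹ *
        A 0 (√((m : ℝ) / n) • signedSum (amplitude n m (Fintype.card (Fin d)) ρ) e ε) u) ∂P.PU :=
        lintegral_mono hu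
    _ = P.jointLaw n 0 {ω | P.T ω.2 = 1} +
        ∑ ε : Fin d → Bool, (Fintype.card (Fin d → Bool) : ENNReal)⁻¹ *
          P.jointLaw n (√((m : ℝ) / n) • signedSum (amplitude n m (Fintype.card (Fin d)) ρ) e ε)
            {ω | P.T ω.2 = 0} := by
        rw [lintegral_add_left (hAmeas 1 0), lintegral_finsetSum _ fun ε _ =>
          (hAmeas _ _).const_mul _]
        simp_rw [lintegral_const_mul _ (hAmeas _ _), hlaw]
    _ ≤ P.risk n ρ := by
        rw [risk]
        refine add_le_add le_rfl ?_
        exact sum_inv_card_mul_le_iSup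
          (fun ε => smul_signedSum_mem_alternative hn hm ρ e.orthonormal ε)
          (fun f => P.jointLaw n f {ω | P.T ω.2 = 0})

end Protocols

end DistributedTesting

end

theorem theorem1 (α : ℝ) (hα : α ∈ Set.Ioo (0 : ℝ) 1) :
    ∃ c : ℝ, 0 < c ∧
      ∀ n m d b : ℕ, 0 < n → 0 < m → 0 < d → 0 < b → ∀ ρ : ℝ,
        (ρ ^ 2 < c * (√(d : ℝ) / (n : ℝ)) * min √((d : ℝ) / min (b : ℝ) (d : ℝ)) √(m : ℝ) →
          ENNReal.ofReal α <
            ⨅ P : DistributedTesting.PublicCoinProtocol.{u, v} m d b, P.risk n ρ) ∧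
        (ρ ^ 2 < c * (√(d : ℝ) / (n : ℝ)) * min ((d : ℝ) / min (b : ℝ) (d : ℝ)) √(m : ℝ) →
          ENNReal.ofReal α <
            ⨅ P : DistributedTesting.PrivateCoinProtocol.{v} m d b, P.risk n ρ) := by
  have hlt : ENNReal.ofReal α < ENNReal.ofReal ((1 + α) / 2) :=
    (ENNReal.ofReal_lt_ofReal_iff (by linarith [hα.1])).2 (by linarith [hα.2])
  -- with `c = (1 - α) / 64`, the second moment exceeds one by at most `((1 - α) / 2) ^ 2`, and the
  -- risk is at least `(1 + α) / 2`
  refine ⟨(1 - α) / 64, by linarith [hα.2], fun n m d b hn hm hd hb ρ => ⟨fun h => ?_, fun h => ?_⟩⟩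
  · exact hlt.trans_le (le_iInf fun P => P.risk_ge hn hm hd hb hα h)
  · exact hlt.trans_le (le_iInf fun P => P.risk_ge hn hm hd hb hα h)
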